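/- **Setting.** Let $\mathcal G=(\mathcal V,\mathcal E)$ be a digraph without self-arcs on $\mathcal V=\{1,\dots,N\}$, $T>0$, $p\in(0,1)$ and $r\in(0,1)^N$. A root is a vertex from which every other vertex can be reached along a directed path; $\mathcal G$ is rooted if it has a root, and $\operatorname{dep}(\mathcal G)$ is the maximum, over all roots $i$ and all vertices $j$, of the length of a shortest path from $i$ to $j$. Let $\mathcal V^*$ be the set of vertices with at least one out-neighbor, let $\mu$ be the law on $\{0,1\}^{\mathcal V^*}$ of independent Bernoulli($p$) digits, and let $v_1,v_2,\dots$ be i.i.d. random variables with law $\mu$ on a probability space $(\Omega,\mathcal F,\mathbb P)$, with $\mathcal F_\ell=\sigma(v_1,\dots,v_\ell)$. The stochastic hybrid system $\mathcal H_S(p,r,\mathcal G)$ has flow set $C=[0,1]^N$, flow $\dot\tau=\frac1T\mathbf 1_N$, jump set $D=\{\tau\in C:\max_i\tau_i=1\}$ and jumps $\tau^+\in G_S(\tau,v_k)$ at the $k$-th jump. Here $G_S(\cdot,v)$ is the outer semicontinuous hull (the graph is the closure) of the set-valued map $G_S^0(\cdot,v)$ that is nonempty only if $\tau_i=1$ for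 exactly one $i$ and $\tau_j\in[0,1)$ for all $j\ne i$, and then consists of all $g\in\mathbb R^N$ with $g_i=0$ and, for $j\neq i$: $g_j=\tau_j$ if $(i,j)\notin\mathcal E$, and $g_j\in v_i\bar{\mathcal R}_j(\tau_j)+(1-v_i)\tau_j$ if $(i,j)\in\mathcal E$. Here $v_i$ is the digit of $v$ at $i$, and $\bar{\mathcal R}_j$ is the outer semicontinuous hull of $\mathcal R_j$, where $\mathcal R_j(s)=\{0\}$ for $s\in[0,r_j)$, $\mathcal R_j(r_j)=\{0,1\}$, and $\mathcal R_j(s)=\{1\}$ for $s\in(r_j,1]$. A random solution from $x_0\in C\cup D$ is a map $\omega\mapsto\boldsymbol\tau_\omega$ into hybrid arcs (functions of $(t,k)$ on a hybrid time domain) with $\boldsymbol\tau_\omega(0,0)=x_0$, such that every $\boldsymbol\tau_\omega$ satisfies the flow and jump conditions above with inputs $v_k(\omega)$, the graph of $\boldsymbol\tau_\omega$ is closed and depends $\mathcal F$-measurably on $\omega$, and its part with at most $\ell$ jumps depends $\mathcal F_\ell$-measurably on $\omega$, for every $\ell\ge 0$. It is maximal if, for almost every $\omega$, $\boldsymbol\tau_\omega$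 has no proper extension to a solution with the same inputs. A sample path is non-trivial if its time domain has at least two points, and complete if its time domain is unbounded. A random solution is almost surely uniformly non-Zeno if there are $b,K>0$ such that for almost every $\omega$, $t_2-t_1\le b$ implies $k_2-k_1\le K$ for all $(t_1,k_1),(t_2,k_2)\in\operatorname{dom}\boldsymbol\tau_\omega$. Let $\mathcal A_s=\{c\mathbf 1_N:c\in[0,1]\}\cup\{0,1\}^N$, and let $\mathbb B$, $\mathbb B^\circ$ be the closed and open Euclidean unit balls. **Theorem.** Suppose that $\mathcal G$ is rooted. Then $(p,r,\mathcal G)$ is a sync-triplet, that is: 1. From every $x_0\in C\cup D$ there is an almost surely non-trivial random solution, and every maximal random solution is almost surely complete and uniformly non-Zeno. 2. $\mathcal A_s$ is uniformly globally asymptotically stable in probability: (a) for all $\varepsilon,\varrho>0$ there is $\delta>0$ such that every maximal random solution from every $x_0\in\mathcal A_s+\delta\mathbb B$ satisfies $$\mathbb P\big(\boldsymbol\tau_\omega(t,k)\in\mathcal A_s+\varepsilon\mathbb B^\circ\ \ \forall (t,k)\in\operatorname{dom}\boldsymbol\tau_\omega\big)\ge1-\varrho;$$ (b) for all $\delta,\varrho>0$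 there is $\varepsilon>0$ such that the same holds; (c) for all $\varepsilon,\varrho,R>0$ there is $\gamma\ge0$ such that every random solution from every $x_0\in\mathcal A_s+R\mathbb B$ satisfies $$\mathbb P\big(\boldsymbol\tau_\omega(t,k)\in\mathcal A_s+\varepsilon\mathbb B^\circ\ \ \forall (t,k)\in\operatorname{dom}\boldsymbol\tau_\omega\text{ with }t+k\ge\gamma\big)\ge1-\varrho.$$ Moreover, suppose that $N\ge2$, and put $\ell^*=N(\lfloor1/\min_ir_i\rfloor+1)$, $T^*=(\operatorname{dep}(\mathcal G)\,\ell^*+1)T$ and $$\rho=1-\big(p(1-p)^{\operatorname{dep}(\mathcal G)-1}\big)^{N\ell^*}.$$ Then $\rho\in(0,1)$, and for every maximal random solution $\boldsymbol\tau_\omega$ (from any initial condition) the sync-time $\boldsymbol T^*(\boldsymbol\tau_\omega)=\inf\{t:\boldsymbol\tau_\omega(t,k)\in\mathcal A_s\text{ for some }(t,k)\in\operatorname{dom}\boldsymbol\tau_\omega\}$ (with $\inf\varnothing=\infty$) satisfies $$\mathbb P\big(\boldsymbol T^*(\boldsymbol\tau_\omega)>nT^*\big)\le\rho^n\qquad\text{for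 all integers }n\ge1.$$ -/

import Mathlib

open Set MeasureTheory ProbabilityTheory Topology
open scoped Pointwise ENNReal

noncomputable section

namespace HybridSync

/-! ### Rooted digraphs and their depth -/

section Graph

variable {N : ℕ}

/-- There is a path with `m` edges, with pairwise distinct vertices, from `i` to `j`. -/
def HasPath (G : Digraph (Fin N)) (i j : Fin N) (m : ℕ) : Prop :=
  ∃ c : Fin (m + 1) → Fin N, Function.Injective c ∧ c 0 = i ∧ c (Fin.last m) = j ∧
    ∀ l : Fin m, G.Adj (c l.castSucc) (c l.succ)

/-- A root: every other vertex can be reached from it. -/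
def IsRoot (G : Digraph (Fin N)) (i : Fin N) : Prop :=
  ∀ j, j ≠ i → ∃ m, HasPath G i j m

/-- A rooted digraph has at least one root. -/
def IsRooted (G : Digraph (Fin N)) : Prop := ∃ i, IsRoot G i

/-- A simple digraph has no self-arcs. -/
def IsSimple (G : Digraph (Fin N)) : Prop := ∀ i, ¬ G.Adj i i

/-- Depth of the vertex `j` with respect to the root `i`: length of a shortest path. -/
def vertexDepth (G : Digraph (Fin N)) (i j : Fin N) : ℕ := sInf {m | HasPath G i j m}

/-- Maximal depth of a vertex with respect to the root `i`. -/
def rootDepth (G : Digraph (Fin N)) (i : Fin N) : ℕ := Finset.univ.sup (vertexDepth G i)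

open scoped Classical in
/-- Depth of a rooted digraph: the maximum of `rootDepth` over all the roots. -/
def dep (G : Digraph (Fin N)) : ℕ := (Finset.univ.filter (IsRoot G)).sup (rootDepth G)

end Graph

/-! ### Hybrid time domains and hybrid arcs -/

/-- `⋃_{k ≤ K} [t_k, t_{k+1}] × {k}` with `0 = t_0 ≤ t_1 ≤ ⋯ ≤ t_{K+1}`. -/
def IsCompactHybridTimeDomain (S : Set (ℝ × ℕ)) : Prop :=
  ∃ (K : ℕ) (t : ℕ → ℝ), t 0 = 0 ∧ (∀ k ≤ K, t k ≤ t (k + 1)) ∧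
    S = {q | q.2 ≤ K ∧ q.1 ∈ Icc (t q.2) (t (q.2 + 1))}

/-- A subset of `ℝ≥0 × ℕ` all of whose truncations are compact hybrid time domains. -/
def IsHybridTimeDomain (S : Set (ℝ × ℕ)) : Prop :=
  (∀ q ∈ S, 0 ≤ q.1) ∧
    ∀ (b : ℝ) (K : ℕ), 0 ≤ b → IsCompactHybridTimeDomain (S ∩ Icc 0 b ×ˢ Iic K)

/-- A hybrid arc with values in `E`. The values `val t k` with `(t, k) ∉ dom` are meaningless,
and no notion below depends on them. -/
structure HybridArc (E : Type*) [PseudoMetricSpace E] where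
  dom : Set (ℝ × ℕ)
  val : ℝ → ℕ → E
  isHybridTimeDomain : IsHybridTimeDomain dom
  absCont : ∀ (k : ℕ) (a b : ℝ), a ≤ b → (a, k) ∈ dom → (b, k) ∈ dom →
    AbsolutelyContinuousOnInterval (fun t => val t k) a b

namespace HybridArc

variable {E : Type*} [PseudoMetricSpace E]

/-- The graph of a hybrid arc. -/
def graph (x : HybridArc E) : Set (ℝ × ℕ × E) :=
  {q | (q.1, q.2.1) ∈ x.dom ∧ q.2.2 = x.val q.1 q.2.1}

/-- The part of the graph with at most `l` jumps. -/
def graphLE (x : HybridArc E) (l : ℕ) : Set (ℝ × ℕ × E) :=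
  {q | q ∈ x.graph ∧ q.2.1 ≤ l}

/-- The hybrid time domain contains at least two points. -/
def IsNontrivial (x : HybridArc E) : Prop := x.dom.Nontrivial

/-- The hybrid time domain is unbounded. -/
def IsComplete (x : HybridArc E) : Prop := ¬ Bornology.IsBounded x.dom

/-- At most `K` jumps in every period of length `b`. -/
def IsUniformlyNonZenoWith (x : HybridArc E) (b K : ℝ) : Prop :=
  ∀ t₁ k₁ t₂ k₂, (t₁, k₁) ∈ x.dom → (t₂, k₂) ∈ x.dom → t₂ - t₁ ≤ b → (k₂ : ℝ) - (k₁ : ℝ) ≤ K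

/-- The first continuous time at which the arc is in `A`; it is `⊤` if the arc never is in `A`. -/
def hittingTime (x : HybridArc E) (A : Set E) : EReal :=
  sInf {s | ∃ t k, (t, k) ∈ x.dom ∧ x.val t k ∈ A ∧ s = (t : EReal)}

end HybridArc

/-! ### Stochastic hybrid dynamical systems -/

/-- Data `(C, f, D, G)` and the law `μ` of the random inputs of the system
`x ∈ C, ẋ = f x` and `x ∈ D, x⁺ ∈ G (x, v⁺), v ∼ μ`. -/
structure SHDS (E V : Type*) [MeasurableSpace V] where
  C : Set E
  f : E → E
  D : Set E
  G : E → V → Set E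
  μ : Measure V

section Solutions

variable {E V Ω : Type*} [NormedAddCommGroup E] [NormedSpace ℝ E] [MeasurableSpace V]
  [MeasurableSpace Ω]

/-- The inputs `v 0, v 1, …` are independent random variables with the law `μ` of the system.
The `k`-th jump (counted from `0`) uses the input `v k`. -/
structure IsInputSequence (H : SHDS E V) (P : Measure Ω) (v : ℕ → Ω → V) : Prop where
  measurable : ∀ k, Measurable (v k)
  indep : iIndepFun v P
  law : ∀ k, Measure.map (v k) P = H.μ

/-- The sigma-algebra that is generated by the first `l` inputs. -/
@[reducible] def inputFiltration (v : ℕ → Ω → V) (l : ℕ) : MeasurableSpace Ω :=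
  ⨆ k : Fin l, MeasurableSpace.comap (v k) inferInstance

/-- Measurability of a set-valued map with respect to the sigma-algebra `m`. -/
def IsMeasurableSetValued {X : Type*} [TopologicalSpace X] (m : MeasurableSpace Ω)
    (M : Ω → Set X) : Prop :=
  ∀ O : Set X, IsOpen O → MeasurableSet[m] {ω | (M ω ∩ O).Nonempty}

/-- The hybrid arc `x` solves the system that is driven by the deterministic input sequence `w`. -/
structure IsSolution (H : SHDS E V) (w : ℕ → V) (x : HybridArc E) : Prop where
  init : x.val 0 0 ∈ H.C ∪ H.D
  flow : ∀ (k : ℕ) (t₁ t₂ : ℝ), (t₁, k) ∈ x.dom → (t₂, k) ∈ x.dom → t₁ < t₂ →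
    ∀ t ∈ Icc t₁ t₂, x.val t k ∈ H.C ∧
      HasDerivWithinAt (fun s => x.val s k) (H.f (x.val t k)) (Icc t₁ t₂) t
  jump : ∀ (k : ℕ) (t : ℝ), (t, k) ∈ x.dom → (t, k + 1) ∈ x.dom →
    x.val t k ∈ H.D ∧ x.val t (k + 1) ∈ H.G (x.val t k) (w k)

/-- A solution without a proper extension to a solution with the same inputs. -/
def IsMaximalSolution (H : SHDS E V) (w : ℕ → V) (x : HybridArc E) : Prop :=
  IsSolution H w x ∧
    ∀ y : HybridArc E, IsSolution H w y → x.dom ⊆ y.dom →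
      (∀ t k, (t, k) ∈ x.dom → y.val t k = x.val t k) → y.dom = x.dom

/-- A random solution from `x₀`: a stochastic hybrid arc, adapted to the inputs, each of whose
sample paths is a solution for the corresponding sample of the inputs. -/
structure IsRandomSolution (H : SHDS E V) (v : ℕ → Ω → V) (x₀ : E) (x : Ω → HybridArc E) :
    Prop where
  closed_graph : ∀ ω, IsClosed (x ω).graph
  measurable_graph : IsMeasurableSetValued (inferInstance : MeasurableSpace Ω)
    fun ω => (x ω).graph
  adapted : ∀ l, IsMeasurableSetValued (inputFiltration v l) fun ω => (x ω).graphLE l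
  init : ∀ ω, (x ω).val 0 0 = x₀
  solution : ∀ ω, IsSolution H (fun k => v k ω) (x ω)

/-- A random solution almost all of whose sample paths are maximal. -/
def IsMaximalRandomSolution (H : SHDS E V) (P : Measure Ω) (v : ℕ → Ω → V) (x₀ : E)
    (x : Ω → HybridArc E) : Prop :=
  IsRandomSolution H v x₀ x ∧ ∀ᵐ ω ∂P, IsMaximalSolution H (fun k => v k ω) (x ω)

/-- `P (x (t, k) ∈ A + ε 𝔹° for all (t, k) ∈ dom x with t + k ≥ γ) ≥ 1 - ρ`, expressed by means
of the complementary event. -/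
def StaysNear (P : Measure Ω) (x : Ω → HybridArc E) (A : Set E) (ε ρ γ : ℝ) : Prop :=
  P {ω | ¬ ∀ t k, (t, k) ∈ (x ω).dom → γ ≤ t + (k : ℝ) →
    (x ω).val t k ∈ A + Metric.ball 0 ε} ≤ ENNReal.ofReal ρ

/-- Uniform Lyapunov stability in probability. -/
def LyapunovStableInProbability (H : SHDS E V) (P : Measure Ω) (v : ℕ → Ω → V) (A : Set E) :
    Prop :=
  ∀ ε > 0, ∀ ρ > 0, ∃ δ > 0, ∀ x₀ ∈ A + Metric.closedBall (0 : E) δ,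
    ∀ x, IsMaximalRandomSolution H P v x₀ x → StaysNear P x A ε ρ 0

/-- Uniform Lagrange stability in probability. -/
def LagrangeStableInProbability (H : SHDS E V) (P : Measure Ω) (v : ℕ → Ω → V) (A : Set E) :
    Prop :=
  ∀ δ > 0, ∀ ρ > 0, ∃ ε > 0, ∀ x₀ ∈ A + Metric.closedBall (0 : E) δ,
    ∀ x, IsMaximalRandomSolution H P v x₀ x → StaysNear P x A ε ρ 0

/-- Uniform global attractivity in probability (for all random solutions, maximal or not). -/
def GloballyAttractiveInProbability (H : SHDS E V) (P : Measure Ω) (v : ℕ → Ω → V) (A : Set E) :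
    Prop :=
  ∀ ε > 0, ∀ ρ > 0, ∀ R > 0, ∃ γ : ℝ, 0 ≤ γ ∧ ∀ x₀ ∈ A + Metric.closedBall (0 : E) R,
    ∀ x, IsRandomSolution H v x₀ x → StaysNear P x A ε ρ γ

/-- Uniform global asymptotic stability in probability. -/
def UGASp (H : SHDS E V) (P : Measure Ω) (v : ℕ → Ω → V) (A : Set E) : Prop :=
  LyapunovStableInProbability H P v A ∧ LagrangeStableInProbability H P v A ∧
    GloballyAttractiveInProbability H P v A

end Solutions

/-! ### The network of pulse-coupled oscillators -/

/-- Outer semicontinuous hull: the set-valued map whose graph is the closure of that of `M`. -/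
def oscHull {X Y : Type*} [TopologicalSpace X] [TopologicalSpace Y] (M : X → Set Y) (x : X) :
    Set Y :=
  {y | (x, y) ∈ closure {q : X × Y | q.2 ∈ M q.1}}

/-- The binary phase update rule with threshold `ρ`, on `[0, 1]`. -/
def phaseUpdate (ρ τ : ℝ) : Set ℝ :=
  {y | (τ ∈ Ico 0 ρ ∧ y = 0) ∨ (τ = ρ ∧ (y = 0 ∨ y = 1)) ∨ (τ ∈ Ioc ρ 1 ∧ y = 1)}

section Network

variable {N : ℕ}

/-- The state space `ℝ^N` with the Euclidean norm. -/
abbrev State (N : ℕ) : Type := EuclideanSpace ℝ (Fin N)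

/-- Binary sequences with one digit for each vertex that has at least one out-neighbor. They
represent the feasible subgraphs of `G`: the digit of `i` tells whether the out-edges of `i` are
kept (all of them) or deleted (all of them). -/
abbrev Input (G : Digraph (Fin N)) : Type := {i : Fin N // ∃ j, G.Adj i j} → Bool

open scoped Classical in
/-- The law of a random feasible subgraph: the digits are independent Bernoulli `p` variables, so
that a sequence `s` has the probability `∏ i, (p if s i = 1, 1 - p if s i = 0)`. -/
def inputLaw (p : ℝ) (G : Digraph (Fin N)) : Measure (Input G) :=
  ∑ s : Input G, ENNReal.ofReal (∏ i, if s i then p else 1 - p) • Measure.dirac s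

/-- `S_{ij}(τ_j, v) = v_i R̄_j(τ_j) + (1 - v_i) τ_j`, where `d` is the digit `v_i` and `ρ` the
threshold of `j`. -/
def edgeUpdate (ρ τ : ℝ) (d : Bool) : Set ℝ :=
  {z | ∃ y ∈ oscHull (phaseUpdate ρ) τ,
    z = (if d then 1 else 0) * y + (1 - if d then 1 else 0) * τ}

/-- The jump map at the states where exactly one agent `i` is at `1`; it is empty elsewhere. -/
def jumpMapPre (r : Fin N → ℝ) (G : Digraph (Fin N)) (τ : State N) (v : Input G) :
    Set (State N) :=
  {g | ∃ i, τ i = 1 ∧ (∀ j, j ≠ i → τ j ∈ Ico 0 1) ∧ g i = 0 ∧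
    ∀ j, j ≠ i →
      (∀ h : G.Adj i j, g j ∈ edgeUpdate (r j) (τ j) (v ⟨i, j, h⟩)) ∧
      (¬ G.Adj i j → g j = τ j)}

/-- The jump map: the outer semicontinuous hull of `jumpMapPre` (the inputs are discrete). -/
def jumpMap (r : Fin N → ℝ) (G : Digraph (Fin N)) (τ : State N) (v : Input G) :
    Set (State N) :=
  oscHull (fun τ' => jumpMapPre r G τ' v) τ

/-- The flow set `[0, 1]^N`. -/
def flowSet (N : ℕ) : Set (State N) := {τ | ∀ i, τ i ∈ Icc 0 1}

/-- The jump set: states in `[0, 1]^N` with largest coordinate `1`. -/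
def jumpSet (N : ℕ) : Set (State N) := {τ | τ ∈ flowSet N ∧ ∃ i, τ i = 1}

/-- The stochastic hybrid dynamical system `H_S(p, r, G)` of a network of pulse-coupled oscillators
with period `T`, triggering probability `p`, thresholds `r` and information flow digraph `G`. -/
def oscillatorNetwork (T p : ℝ) (r : Fin N → ℝ) (G : Digraph (Fin N)) :
    SHDS (State N) (Input G) where
  C := flowSet N
  f := fun _ => WithLp.toLp 2 fun _ => 1 / T
  D := jumpSet N
  G := jumpMap r G
  μ := inputLaw p G

/-- The synchronization set `{c 1_N : c ∈ [0, 1]} ∪ {0, 1}^N`. -/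
def syncSet (N : ℕ) : Set (State N) :=
  {τ | ∃ c ∈ Icc (0 : ℝ) 1, ∀ i, τ i = c} ∪ {τ | ∀ i, τ i = 0 ∨ τ i = 1}

/-- `(p, r, G)` is a sync-triplet (for the period `T` and a given sequence of random inputs). -/
structure IsSyncTriplet {Ω : Type*} [MeasurableSpace Ω] (T p : ℝ) (r : Fin N → ℝ)
    (G : Digraph (Fin N)) (P : Measure Ω) (v : ℕ → Ω → Input G) : Prop where
  exists_nontrivial : ∀ x₀ ∈ flowSet N ∪ jumpSet N, ∃ x : Ω → HybridArc (State N),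
    IsRandomSolution (oscillatorNetwork T p r G) v x₀ x ∧ ∀ᵐ ω ∂P, (x ω).IsNontrivial
  complete_nonZeno : ∀ x₀ ∈ flowSet N ∪ jumpSet N, ∀ x : Ω → HybridArc (State N),
    IsMaximalRandomSolution (oscillatorNetwork T p r G) P v x₀ x →
      (∀ᵐ ω ∂P, (x ω).IsComplete) ∧
      ∃ b > 0, ∃ K > 0, ∀ᵐ ω ∂P, (x ω).IsUniformlyNonZenoWith b K
  stable : UGASp (oscillatorNetwork T p r G) P v (syncSet N)

/-- `ℓ* = N (⌊1 / min_i r_i⌋ + 1)`. -/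
def ellStar (r : Fin N → ℝ) : ℕ := N * (⌊1 / ⨅ i, r i⌋₊ + 1)

/-- `T* = (dep(G) ℓ* + 1) T`. -/
def TStar (T : ℝ) (r : Fin N → ℝ) (G : Digraph (Fin N)) : ℝ :=
  ((dep G : ℝ) * (ellStar r : ℝ) + 1) * T

/-- `ρ = 1 - (p (1 - p)^(dep(G) - 1))^(N ℓ*)`, for `dep(G) ≥ 1`. -/
def rhoStar (p : ℝ) (r : Fin N → ℝ) (G : Digraph (Fin N)) : ℝ :=
  1 - (p * (1 - p) ^ (dep G - 1)) ^ (N * ellStar r)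

end Network

end HybridSync

end

/-!
A jump of the network is the firing of a single agent at phase `1` (`mem_jumpMap_iff`). This gives
two deterministic facts.

* `firingPotential`, the sum of `min τⱼ rⱼ / rⱼ` over the agents, drops by `1` at each firing and
  grows at a bounded rate along flows. So the number of jumps in a time interval is bounded, solutions
  are uniformly non-Zeno, and a maximal solution, which can always be continued, is complete.
* If the phases modulo `1` lie in an arc of length `η`, then they do so forever (`FiresTo.inArc`),
  because a firing moves other agents only to `0 ≡ 1`, where the firing agent is. States in short
  arcs are close to `syncSet`, and for `η = 0` the states are those of `syncSet`. So `syncSet` is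
  stable and forward invariant on every sample path.

For attractivity, some digits of the inputs are prescribed. If the agents that fire together with a
root `i` use the digit `1`, and the agents that fire at other times use the digit `0`, then each
firing of `i` synchronizes one more layer of the digraph with `i`, and the network is synchronized
after `dep G` periods (`exists_strategy_of_isRoot`). If the depth is `1`, then no digit `0` is needed:
the first root that fires with the digit `1` synchronizes the network
(`exists_strategy_of_dep_le_one`). As the selection of the firing agent among those at `1` may depend
on the current input, the digits of all of them have to be prescribed, for each of the at most `N`
jumps that an agent has to wait for its own. The costs `onesCost` and `zerosCost` keep count of this.
They stay within `N ℓ*` digits `1` and `(dep G - 1) N ℓ*` digits `0`, since `2 N ≤ ℓ*`.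

An adapted solution with closed graphs is determined, up to the `k`-th jump, by the first `k` inputs
(`IsRandomSolution.graphLE_eq`), and these take finitely many values. Hence conditional probabilities
are probabilities on cylinders, and all the bounds are proved for one further input at a time. When
an input deviates from the prescribed digits, the next window starts at this jump. So the probability
of no synchronization is multiplied by at most `ρ` for each window of length `T*`
(`measure_desyncEvent_le`).
-/

noncomputable section

namespace HybridSync

/-! ### The jump map in explicit form -/

section JumpMap

lemma isClosed_graph_phaseUpdate {ρ : ℝ} (hρ : ρ ∈ Ioo (0 : ℝ) 1) :
    IsClosed {q : ℝ × ℝ | q.2 ∈ phaseUpdate ρ q.1} := by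
  have : {q : ℝ × ℝ | q.2 ∈ phaseUpdate ρ q.1} = Icc 0 ρ ×ˢ {0} ∪ Icc ρ 1 ×ˢ {1} := by
    ext ⟨a, b⟩
    simp only [phaseUpdate, mem_Ico, mem_Ioc, mem_ofPred_eq, mem_union, mem_prod, mem_Icc,
      mem_singleton_iff]
    constructor
    · rintro (⟨h, rfl⟩ | ⟨rfl, rfl | rfl⟩ | ⟨h, rfl⟩)
      · exact Or.inl ⟨⟨h.1, h.2.le⟩, rfl⟩
      · exact Or.inl ⟨⟨hρ.1.le, le_rfl⟩, rfl⟩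
      · exact Or.inr ⟨⟨le_rfl, hρ.2.le⟩, rfl⟩
      · exact Or.inr ⟨⟨h.1.le, h.2⟩, rfl⟩
    · rintro (⟨h, rfl⟩ | ⟨h, rfl⟩)
      · rcases h.2.lt_or_eq with h' | h'
        · exact Or.inl ⟨⟨h.1, h'⟩, rfl⟩
        · exact Or.inr (Or.inl ⟨h', Or.inl rfl⟩)
      · rcases h.1.lt_or_eq with h' | h'
        · exact Or.inr (Or.inr ⟨⟨h', h.2⟩, rfl⟩)
        · exact Or.inr (Or.inl ⟨h'.symm, Or.inr rfl⟩)
  rw [this]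
  exact (isClosed_Icc.prod isClosed_singleton).union (isClosed_Icc.prod isClosed_singleton)

lemma oscHull_phaseUpdate {ρ : ℝ} (hρ : ρ ∈ Ioo (0 : ℝ) 1) :
    oscHull (phaseUpdate ρ) = phaseUpdate ρ := by
  funext τ
  ext y
  rw [oscHull, mem_ofPred_eq, (isClosed_graph_phaseUpdate hρ).closure_eq]
  rfl

lemma phaseUpdate_nonempty {ρ τ : ℝ} (hτ : τ ∈ Icc (0 : ℝ) 1) : (phaseUpdate ρ τ).Nonempty := by
  rcases lt_trichotomy τ ρ with h | h | h
  · exact ⟨0, Or.inl ⟨⟨hτ.1, h⟩, rfl⟩⟩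
  · exact ⟨0, Or.inr (Or.inl ⟨h, Or.inl rfl⟩)⟩
  · exact ⟨1, Or.inr (Or.inr ⟨⟨h, hτ.2⟩, rfl⟩)⟩

lemma mem_edgeUpdate_iff {ρ τ z : ℝ} (hρ : ρ ∈ Ioo (0 : ℝ) 1) (hτ : τ ∈ Icc (0 : ℝ) 1)
    {d : Bool} :
    z ∈ edgeUpdate ρ τ d ↔ (d = true → z ∈ phaseUpdate ρ τ) ∧ (d = false → z = τ) := by
  rw [edgeUpdate, oscHull_phaseUpdate hρ]
  cases d
  · have : ∃ y, y ∈ phaseUpdate ρ τ := phaseUpdate_nonempty hτ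
    simpa using fun _ => this
  · simp

variable {N : ℕ}

/-- Agent `i` of the state `z` fires and produces `g`: its own phase is reset from `1` to `0`, and
the phases of its out-neighbors are updated if its digit is `1`. -/
def FiresTo (r : Fin N → ℝ) (G : Digraph (Fin N)) (i : Fin N) (z : State N) (s : Input G)
    (g : State N) : Prop :=
  z ∈ flowSet N ∧ z i = 1 ∧ g i = 0 ∧ ∀ j, j ≠ i →
    (∀ h : G.Adj i j, (s ⟨i, j, h⟩ = true → g j ∈ phaseUpdate (r j) (z j)) ∧
      (s ⟨i, j, h⟩ = false → g j = z j)) ∧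
    (¬ G.Adj i j → g j = z j)

variable {r : Fin N → ℝ} {G : Digraph (Fin N)}

lemma isClosed_flowSet (N : ℕ) : IsClosed (flowSet N) := by
  unfold flowSet
  simp only [ofPred_forall]
  refine isClosed_iInter fun j => isClosed_Icc.preimage (?_ : Continuous fun τ : State N => τ j)
  fun_prop

lemma isClosed_setOf_firesTo (hr : ∀ i, r i ∈ Ioo (0 : ℝ) 1) (i : Fin N) (s : Input G) :
    IsClosed {q : State N × State N | FiresTo r G i q.1 s q.2} := by
  have c1 : ∀ j : Fin N, Continuous fun q : State N × State N => q.1 j := fun j => by fun_prop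
  have c2 : ∀ j : Fin N, Continuous fun q : State N × State N => q.2 j := fun j => by fun_prop
  have e : ∀ j : Fin N, IsClosed {q : State N × State N | q.2 j = q.1 j} :=
    fun j => isClosed_eq (c2 j) (c1 j)
  unfold FiresTo
  simp only [ofPred_and, ofPred_forall]
  refine IsClosed.inter ((isClosed_flowSet N).preimage continuous_fst) ?_
  refine IsClosed.inter (isClosed_eq (c1 i) continuous_const) ?_
  refine IsClosed.inter (isClosed_eq (c2 i) continuous_const) ?_
  refine isClosed_iInter fun j => isClosed_iInter fun _ => IsClosed.inter ?_ ?_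
  · refine isClosed_iInter fun h => IsClosed.inter ?_ ?_
    · exact isClosed_iInter fun _ =>
        (isClosed_graph_phaseUpdate (hr j)).preimage ((c1 j).prodMk (c2 j))
    · exact isClosed_iInter fun _ => e j
  · exact isClosed_iInter fun _ => e j

/-- In the closure of the graph of `jumpMapPre`, exactly one agent fires at a time, and every agent
at `1` may be the one: the states with a single agent at `1` approximate the remaining ones. -/
theorem mem_jumpMap_iff (hr : ∀ i, r i ∈ Ioo (0 : ℝ) 1) {z g : State N} {s : Input G} :
    g ∈ jumpMap r G z s ↔ ∃ i, FiresTo r G i z s g := by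
  constructor
  · intro hg
    have hcl : IsClosed {q : State N × State N | ∃ i, FiresTo r G i q.1 s q.2} := by
      rw [ofPred_exists]
      exact isClosed_iUnion_of_finite fun i => isClosed_setOf_firesTo hr i s
    refine closure_minimal ?_ hcl hg
    rintro ⟨τ, y⟩ ⟨i, hi, hlt, h0, hj⟩
    have hfl : τ ∈ flowSet N := fun j => by
      by_cases h : j = i
      · subst h; exact ⟨hi ▸ zero_le_one, hi.le⟩
      · exact ⟨(hlt j h).1, (hlt j h).2.le⟩
    refine ⟨i, hfl, hi, h0, fun j hji => ⟨fun h => ?_, (hj j hji).2⟩⟩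
    exact (mem_edgeUpdate_iff (hr j) (hfl j)).1 ((hj j hji).1 h)
  · rintro ⟨i, hfl, hi, h0, hj⟩
    -- `i` stays at `1`, and the phases of the other agents are cut off at `1 - ε`
    let zε : ℝ → State N := fun ε =>
      WithLp.toLp 2 fun j => if j = i then 1 else min (z j) (1 - ε)
    let keep : Fin N → Prop := fun j => ∃ h : G.Adj i j, s ⟨i, j, h⟩ = true
    classical
    let gε : ℝ → State N := fun ε =>
      WithLp.toLp 2 fun j => if j = i then 0 else if keep j then g j else min (z j) (1 - ε)
    have hmin : ∀ j, Filter.Tendsto (fun ε : ℝ => min (z j) (1 - ε)) (𝓝[>] 0) (𝓝 (z j)) := by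
      intro j
      have : Continuous fun ε : ℝ => min (z j) (1 - ε) := by fun_prop
      have h := (this.tendsto 0).mono_left (nhdsWithin_le_nhds (s := Ioi 0))
      simpa [(hfl j).2] using h
    have hz : Filter.Tendsto zε (𝓝[>] 0) (𝓝 z) := by
      have : Filter.Tendsto (fun ε j => if j = i then (1 : ℝ) else min (z j) (1 - ε)) (𝓝[>] 0)
          (𝓝 (WithLp.ofLp z)) := by
        refine tendsto_pi_nhds.2 fun j => ?_
        by_cases h : j = i
        · subst h; simp [hi]
        · simpa [h] using hmin j
      exact ((PiLp.continuous_toLp 2 _).tendsto _).comp this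
    have hgt : Filter.Tendsto gε (𝓝[>] 0) (𝓝 g) := by
      have : Filter.Tendsto (fun ε j => if j = i then (0 : ℝ) else
          if keep j then g j else min (z j) (1 - ε)) (𝓝[>] 0) (𝓝 (WithLp.ofLp g)) := by
        refine tendsto_pi_nhds.2 fun j => ?_
        by_cases h : j = i
        · subst h; simp [h0]
        by_cases hk : keep j
        · simp [h, hk]
        · have : g j = z j := by
            by_cases ha : G.Adj i j
            · refine ((hj j h).1 ha).2 ?_
              by_contra hne
              exact hk ⟨ha, by simpa using hne⟩
            · exact (hj j h).2 ha
          simpa [h, hk, this] using hmin j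
      exact ((PiLp.continuous_toLp 2 _).tendsto _).comp this
    refine mem_closure_of_tendsto (hz.prodMk_nhds hgt) ?_
    have hev : ∀ j, ∀ᶠ ε in 𝓝[>] (0 : ℝ), ε < 1 ∧ ε < 1 - r j ∧ (z j < 1 → ε < 1 - z j) := by
      intro j
      have H : ∀ a : ℝ, 0 < a → ∀ᶠ ε in 𝓝[>] (0 : ℝ), ε < a := fun a ha =>
        (Iio_mem_nhds ha : Iio a ∈ 𝓝 (0 : ℝ)) |> mem_nhdsWithin_of_mem_nhds
      refine (H 1 one_pos).and ((H _ (sub_pos.2 (hr j).2)).and ?_)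
      by_cases h : z j < 1
      · filter_upwards [H _ (sub_pos.2 h)] with ε he _ using he
      · exact Filter.Eventually.of_forall fun _ h' => absurd h' h
    filter_upwards [Filter.eventually_all.2 hev, self_mem_nhdsWithin] with ε hε hpos
    have hpos : 0 < ε := hpos
    have hIco : ∀ j, min (z j) (1 - ε) ∈ Ico (0 : ℝ) 1 := fun j =>
      ⟨le_min (hfl j).1 (by linarith [(hε j).1]), (min_le_right _ _).trans_lt (by linarith)⟩
    refine ⟨i, by simp [zε], fun j h => by simpa [zε, h] using hIco j, by simp [gε],
      fun j h => ⟨fun ha => ?_, fun ha => ?_⟩⟩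
    · have e1 : zε ε j = min (z j) (1 - ε) := by simp [zε, h]
      rw [e1, mem_edgeUpdate_iff (hr j) ⟨(hIco j).1, (hIco j).2.le⟩]
      refine ⟨fun hs => ?_, fun hs => ?_⟩
      · have e2 : gε ε j = g j := by
          have : keep j := ⟨ha, hs⟩
          simp [gε, h, this]
        rw [e2]
        have hg := ((hj j h).1 ha).1 hs
        by_cases hz1 : z j < 1
        · rwa [min_eq_left (by linarith [(hε j).2.2 hz1])]
        · have hz1 : z j = 1 := le_antisymm (hfl j).2 (not_lt.1 hz1)
          rw [hz1] at hg ⊢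
          have hg1 : g j = 1 := by
            rcases hg with ⟨h1, _⟩ | ⟨h1, _⟩ | ⟨_, h1⟩
            · exact absurd h1.2 (hr j).2.not_gt
            · exact absurd h1 (hr j).2.ne'
            · exact h1
          rw [min_eq_right (by linarith)]
          exact Or.inr (Or.inr ⟨⟨by linarith [(hε j).2.1], by linarith⟩, hg1⟩)
      · have : ¬ keep j := fun ⟨_, h2⟩ => by simp [hs] at h2
        simp [gε, h, this]
    · have : ¬ keep j := fun ⟨h2, _⟩ => ha h2
      simp [gε, zε, h, this]

end JumpMap

/-! ### Hybrid time domains -/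

section Domain

variable {S : Set (ℝ × ℕ)}

lemma IsHybridTimeDomain.exists_jumpTimes (hS : IsHybridTimeDomain S) {b : ℝ} (hb : 0 ≤ b)
    (K : ℕ) : ∃ (K' : ℕ) (t : ℕ → ℝ), t 0 = 0 ∧ (∀ k ≤ K', t k ≤ t (k + 1)) ∧
      ∀ u k, ((u, k) ∈ S ∧ u ≤ b ∧ k ≤ K) ↔ k ≤ K' ∧ t k ≤ u ∧ u ≤ t (k + 1) := by
  obtain ⟨K', t, h0, hm, he⟩ := hS.2 b K hb
  refine ⟨K', t, h0, hm, fun u k => ?_⟩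
  have := congrArg (fun A : Set (ℝ × ℕ) => (u, k) ∈ A) he
  simp only [mem_inter_iff, mem_prod, mem_Icc, mem_Iic, mem_ofPred_eq, eq_iff_iff] at this
  rw [← this]
  exact ⟨fun h => ⟨h.1, ⟨hS.1 _ h.1, h.2.1⟩, h.2.2⟩, fun h => ⟨h.1, h.2.1.2, h.2.2⟩⟩

lemma le_of_forall_le_succ {t : ℕ → ℝ} {K : ℕ} (h : ∀ k ≤ K, t k ≤ t (k + 1)) {k l : ℕ}
    (hkl : k ≤ l) (hl : l ≤ K + 1) : t k ≤ t l := by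
  induction l, hkl using Nat.le_induction with
  | base => exact le_rfl
  | succ m _ ih => exact (ih (by lia)).trans (h m (by lia))

lemma IsHybridTimeDomain.zero_mem (hS : IsHybridTimeDomain S) : ((0 : ℝ), 0) ∈ S := by
  obtain ⟨K', t, h0, hm, h⟩ := hS.exists_jumpTimes le_rfl 0
  exact ((h 0 0).2 ⟨Nat.zero_le _, h0.le, h0 ▸ hm 0 (Nat.zero_le _)⟩).1

lemma IsHybridTimeDomain.mem_of_mem_of_mem (hS : IsHybridTimeDomain S) {a b u : ℝ} {k : ℕ}
    (ha : (a, k) ∈ S) (hb : (b, k) ∈ S) (hau : a ≤ u) (hub : u ≤ b) : (u, k) ∈ S := by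
  obtain ⟨K', t, h0, hm, h⟩ := hS.exists_jumpTimes (hS.1 _ hb) k
  have h1 := (h a k).1 ⟨ha, hau.trans hub, le_rfl⟩
  have h2 := (h b k).1 ⟨hb, le_rfl, le_rfl⟩
  exact ((h u k).2 ⟨h1.1, h1.2.1.trans hau, hub.trans h2.2.2⟩).1

lemma IsHybridTimeDomain.le_of_lt (hS : IsHybridTimeDomain S) {a b : ℝ} {k l : ℕ}
    (ha : (a, k) ∈ S) (hb : (b, l) ∈ S) (hkl : k < l) : a ≤ b := by
  have h0b : (0 : ℝ) ≤ max a b := le_max_of_le_left (hS.1 _ ha)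
  obtain ⟨K', t, h0, hm, h⟩ := hS.exists_jumpTimes h0b l
  have h1 := (h a k).1 ⟨ha, le_max_left _ _, hkl.le⟩
  have h2 := (h b l).1 ⟨hb, le_max_right _ _, le_rfl⟩
  exact h1.2.2.trans ((le_of_forall_le_succ hm hkl (by lia)).trans h2.2.1)

/-- Every level but the first one is entered by a jump, at its least time. -/
lemma IsHybridTimeDomain.exists_jump (hS : IsHybridTimeDomain S) {u : ℝ} {k : ℕ}
    (hu : (u, k + 1) ∈ S) : ∃ s ≤ u, (s, k) ∈ S ∧ (s, k + 1) ∈ S := by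
  obtain ⟨K', t, h0, hm, h⟩ := hS.exists_jumpTimes (hS.1 _ hu) (k + 1)
  have h1 := (h u (k + 1)).1 ⟨hu, le_rfl, le_rfl⟩
  refine ⟨t (k + 1), h1.2.1, ?_, ?_⟩
  · exact ((h _ k).2 ⟨by lia, hm k (by lia), le_rfl⟩).1
  · exact ((h _ (k + 1)).2 ⟨h1.1, le_rfl, hm _ h1.1⟩).1

lemma IsHybridTimeDomain.exists_mem_of_le (hS : IsHybridTimeDomain S) {t u : ℝ} {k : ℕ}
    (ht : (t, k) ∈ S) (h0 : 0 ≤ u) (hut : u ≤ t) : ∃ l, (u, l) ∈ S := by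
  induction k generalizing t with
  | zero => exact ⟨0, hS.mem_of_mem_of_mem hS.zero_mem ht h0 hut⟩
  | succ k ih =>
    obtain ⟨s, _, hs, hs'⟩ := hS.exists_jump ht
    rcases le_total u s with h | h
    · exact ih hs h
    · exact ⟨k + 1, hS.mem_of_mem_of_mem hs' ht h hut⟩

/-- Induction along a hybrid time domain, from the point `(t₁, k₁)` on. -/
lemma IsHybridTimeDomain.induction_from (hS : IsHybridTimeDomain S) {M : ℝ → ℕ → Prop} {t₁ : ℝ}
    {k₁ : ℕ} (h₁ : (t₁, k₁) ∈ S) (hM : M t₁ k₁)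
    (flow : ∀ k t t', (t, k) ∈ S → (t', k) ∈ S → t ≤ t' → M t k → M t' k)
    (jump : ∀ k t, (t, k) ∈ S → (t, k + 1) ∈ S → M t k → M t (k + 1))
    {t : ℝ} {k : ℕ} (ht : (t, k) ∈ S) (hk : k₁ ≤ k) (hle : t₁ ≤ t) : M t k := by
  induction k, hk using Nat.le_induction generalizing t with
  | base => exact flow _ _ _ h₁ ht hle hM
  | succ k hk ih =>
    obtain ⟨s, hst, hs, hs'⟩ := hS.exists_jump ht
    have hs₁ : t₁ ≤ s := hS.le_of_lt h₁ hs' (Nat.lt_succ_of_le hk)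
    exact flow _ _ _ hs' ht hst (jump _ _ hs hs' (ih hs hs₁))

/-- The set that is described by finitely many jump times is a hybrid time domain. -/
lemma isHybridTimeDomain_of_jumpTimes {t : ℕ → ℝ} {K : ℕ} (h0 : t 0 = 0)
    (hm : ∀ k ≤ K, t k ≤ t (k + 1)) :
    IsHybridTimeDomain {q : ℝ × ℕ | q.2 ≤ K ∧ q.1 ∈ Icc (t q.2) (t (q.2 + 1))} := by
  refine ⟨fun q hq => ?_, fun b L hb => ?_⟩
  · have h := le_of_forall_le_succ hm (Nat.zero_le q.2) (hq.1.trans (Nat.le_succ K))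
    exact (h0 ▸ h).trans hq.2.1
  · -- the last level of the truncation is the last one that starts up to the time `b`
    set K' := Nat.findGreatest (fun k => t k ≤ b) (min K L) with hK'
    have hK'le : K' ≤ min K L := Nat.findGreatest_le _
    have hK'b : t K' ≤ b := by
      have : (fun k => t k ≤ b) 0 := by simpa [h0] using hb
      exact Nat.findGreatest_spec (P := fun k => t k ≤ b) (Nat.zero_le _) this
    have hle : ∀ k ≤ K', t k ≤ b := fun k hk =>
      (le_of_forall_le_succ hm hk (by lia)).trans hK'b
    refine ⟨K', fun k => min (t k) b, by simpa [h0] using hb, fun k hk =>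
      min_le_min (hm k (by lia)) le_rfl, ?_⟩
    ext ⟨u, k⟩
    simp only [mem_inter_iff, mem_ofPred_eq, mem_prod, mem_Icc, mem_Iic]
    constructor
    · rintro ⟨⟨hk, h1, h2⟩, ⟨h3, h4⟩, h5⟩
      have : k ≤ K' := Nat.le_findGreatest (le_min hk h5) (h1.trans h4)
      exact ⟨this, (min_le_left _ _).trans h1, le_min h2 h4⟩
    · rintro ⟨hk, h1, h2⟩
      rw [min_eq_left (hle k hk)] at h1
      have h0' := le_of_forall_le_succ hm (Nat.zero_le k) (by lia)
      exact ⟨⟨by lia, h1, h2.trans (min_le_left _ _)⟩,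
        ⟨(h0 ▸ h0').trans h1, h2.trans (min_le_right _ _)⟩, by lia⟩

end Domain

/-! ### Solutions of the oscillator network -/

section Network

variable {N : ℕ} {T p : ℝ} {r : Fin N → ℝ} {G : Digraph (Fin N)}

/-- All phases are increased by `c`. -/
def shift (y : State N) (c : ℝ) : State N := WithLp.toLp 2 fun i => y i + c

@[simp] lemma shift_apply (y : State N) (c : ℝ) (i : Fin N) : shift y c i = y i + c := rfl

@[simp] lemma shift_zero (y : State N) : shift y 0 = y := by ext i; simp

lemma shift_shift (y : State N) (a b : ℝ) : shift (shift y a) b = shift y (a + b) := by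
  ext i; simp [add_assoc]

lemma FiresTo.mem_flowSet {i : Fin N} {z g : State N} {s : Input G} (h : FiresTo r G i z s g) :
    g ∈ flowSet N := by
  intro j
  by_cases hji : j = i
  · subst hji; simp [h.2.2.1]
  obtain ⟨h1, h2⟩ := h.2.2.2 j hji
  by_cases ha : G.Adj i j
  · obtain ⟨h3, h4⟩ := h1 ha
    cases hs : s ⟨i, j, ha⟩
    · exact h4 hs ▸ h.1 j
    · rcases h3 hs with ⟨_, h⟩ | ⟨_, h | h⟩ | ⟨_, h⟩ <;> simp [h]
  · exact h2 ha ▸ h.1 j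

lemma IsSolution.init_mem_flowSet {w : ℕ → Input G} {x : HybridArc (State N)}
    (hx : IsSolution (oscillatorNetwork T p r G) w x) : x.val 0 0 ∈ flowSet N :=
  hx.init.elim id fun h => h.1

/-- Jumps of a solution are firings of single agents. -/
lemma IsSolution.exists_firesTo (hr : ∀ i, r i ∈ Ioo (0 : ℝ) 1) {w : ℕ → Input G}
    {x : HybridArc (State N)} (hx : IsSolution (oscillatorNetwork T p r G) w x) {t : ℝ} {k : ℕ}
    (h1 : (t, k) ∈ x.dom) (h2 : (t, k + 1) ∈ x.dom) :
    ∃ i, FiresTo r G i (x.val t k) (w k) (x.val t (k + 1)) :=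
  (mem_jumpMap_iff hr).1 (hx.jump k t h1 h2).2

lemma IsSolution.mem_flowSet (hr : ∀ i, r i ∈ Ioo (0 : ℝ) 1) {w : ℕ → Input G}
    {x : HybridArc (State N)} (hx : IsSolution (oscillatorNetwork T p r G) w x) {t : ℝ} {k : ℕ}
    (ht : (t, k) ∈ x.dom) : x.val t k ∈ flowSet N := by
  have hS := x.isHybridTimeDomain
  refine hS.induction_from (M := fun t k => x.val t k ∈ flowSet N) hS.zero_mem
    hx.init_mem_flowSet (fun k t t' h h' hle hM => ?_) (fun k t h h' _ => ?_) ht (Nat.zero_le _)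
    (hS.1 _ ht)
  · rcases hle.lt_or_eq with hlt | rfl
    · exact (hx.flow k t t' h h' hlt t' (right_mem_Icc.2 hle)).1
    · exact hM
  · obtain ⟨i, hi⟩ := hx.exists_firesTo hr h h'
    exact hi.mem_flowSet

lemma IsSolution.val_eq_shift {w : ℕ → Input G} {x : HybridArc (State N)}
    (hx : IsSolution (oscillatorNetwork T p r G) w x) {a b : ℝ} {k : ℕ}
    (ha : (a, k) ∈ x.dom) (hb : (b, k) ∈ x.dom) (hab : a ≤ b) :
    x.val b k = shift (x.val a k) ((b - a) / T) := by
  rcases hab.lt_or_eq with hlt | rfl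
  swap
  · simp
  have hfl := hx.flow k a b ha hb hlt
  set F : State N := (oscillatorNetwork T p r G).f 0 with hF
  have hd : ∀ t ∈ Icc a b, HasDerivWithinAt (fun s => x.val s k - (s - a) • F) 0 (Icc a b) t := by
    intro t ht
    have h1 : HasDerivWithinAt (fun s : ℝ => (s - a) • F) ((1 : ℝ) • F) (Icc a b) t :=
      ((hasDerivWithinAt_id t _).sub_const a).smul_const F
    have h2 := (hfl t ht).2.sub h1
    rwa [one_smul, hF, show (oscillatorNetwork T p r G).f (x.val t k)
      = (oscillatorNetwork T p r G).f 0 from rfl, sub_self] at h2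
  have := constant_of_has_deriv_right_zero (f := fun s => x.val s k - (s - a) • F) (a := a) (b := b)
    (fun t ht => (hd t ht).continuousWithinAt)
    (fun t ht => (hd t ⟨ht.1, ht.2.le⟩).mono_of_mem_nhdsWithin (Icc_mem_nhdsGE_of_mem ht))
    b (right_mem_Icc.2 hab)
  simp only [sub_self, zero_smul, sub_zero] at this
  rw [sub_eq_iff_eq_add] at this
  rw [this]
  ext i
  simp [hF, oscillatorNetwork, div_eq_mul_inv]

/-- An increase that leads to a state in which some agent fires is unique. -/
lemma shift_mem_jumpSet_unique {y : State N} {a b : ℝ} (ha : shift y a ∈ jumpSet N)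
    (hb : shift y b ∈ jumpSet N) : a = b := by
  have key : ∀ a b, shift y a ∈ jumpSet N → shift y b ∈ jumpSet N → a ≤ b := by
    intro a b ha hb
    obtain ⟨i, hi⟩ := hb.2
    have := (ha.1 i).2
    simp only [shift_apply] at hi this
    linarith
  exact le_antisymm (key _ _ ha hb) (key _ _ hb ha)

lemma exists_shift_mem_jumpSet [Nonempty (Fin N)] {y : State N} (hy : y ∈ flowSet N) :
    ∃ c, 0 ≤ c ∧ shift y c ∈ jumpSet N := by
  obtain ⟨i, -, hi⟩ := Finset.exists_max_image Finset.univ (fun i => y i) Finset.univ_nonempty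
  have h1 := (hy i).2
  refine ⟨1 - y i, by linarith, fun j => ?_, i, by simp⟩
  have := hi j (Finset.mem_univ _)
  have := (hy j).1
  exact ⟨by simp only [shift_apply]; linarith, by simp only [shift_apply]; linarith⟩

/-- The level `k` of `x` is entered at the time `s`, in the state `y`. -/
def Enters (x : HybridArc (State N)) (k : ℕ) (s : ℝ) (y : State N) : Prop :=
  (s, k) ∈ x.dom ∧ x.val s k = y ∧ ∀ t, (t, k) ∈ x.dom → s ≤ t

lemma enters_zero (x : HybridArc (State N)) : Enters x 0 0 (x.val 0 0) :=
  ⟨x.isHybridTimeDomain.zero_mem, rfl, fun _ ht => x.isHybridTimeDomain.1 _ ht⟩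

/-- A level lasts at most for the time `T`, in which a phase flows from `0` to `1`. -/
lemma IsSolution.le_of_enters (hr : ∀ i, r i ∈ Ioo (0 : ℝ) 1) (hT : 0 < T) [Nonempty (Fin N)]
    {w : ℕ → Input G} {x : HybridArc (State N)}
    (hx : IsSolution (oscillatorNetwork T p r G) w x) {k : ℕ} {s t : ℝ} {y : State N}
    (he : Enters x k s y) (ht : (t, k) ∈ x.dom) : t ≤ s + T := by
  have h1 := hx.val_eq_shift he.1 ht (he.2.2 t ht)
  have i : Fin N := Classical.arbitrary _
  have h2 := (hx.mem_flowSet hr ht i).2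
  have h3 := (hx.mem_flowSet hr he.1 i).1
  rw [h1, shift_apply] at h2
  have : (t - s) / T ≤ 1 := by linarith
  rw [div_le_one hT] at this
  linarith

lemma IsSolution.exists_enters_succ (hr : ∀ i, r i ∈ Ioo (0 : ℝ) 1) (hT : 0 < T)
    {w : ℕ → Input G} {x : HybridArc (State N)}
    (hx : IsSolution (oscillatorNetwork T p r G) w x) {k : ℕ} {s t : ℝ} {y : State N}
    (he : Enters x k s y) (ht : (t, k + 1) ∈ x.dom) :
    ∃ c y', 0 ≤ c ∧ shift y c ∈ jumpSet N ∧ (∃ i, FiresTo r G i (shift y c) (w k) y') ∧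
      Enters x (k + 1) (s + c * T) y' := by
  obtain ⟨u, -, hu, hu'⟩ := x.isHybridTimeDomain.exists_jump ht
  have hsu := he.2.2 u hu
  have h1 := hx.val_eq_shift he.1 hu hsu
  rw [he.2.1] at h1
  refine ⟨(u - s) / T, x.val u (k + 1), div_nonneg (by linarith) hT.le, ?_, ?_, ?_⟩
  · exact h1 ▸ (hx.jump k u hu hu').1
  · exact h1 ▸ hx.exists_firesTo hr hu hu'
  · rw [div_mul_cancel₀ _ hT.ne', add_sub_cancel]
    exact ⟨hu', rfl, fun t ht => x.isHybridTimeDomain.le_of_lt hu ht (Nat.lt_succ_self k)⟩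

end Network

section Deterministic

variable {N : ℕ} {T p : ℝ} {r : Fin N → ℝ} {G : Digraph (Fin N)}

/-! ### Bounding the number of jumps -/

/-- A potential that drops by at least `1` at each firing: an agent that fires has the phase `0`
afterwards, and has to flow up to its threshold before another agent can push it to `1`. -/
def firingPotential (r : Fin N → ℝ) (y : State N) : ℝ := ∑ j, min (y j) (r j) / r j

/-- Growth rate of `firingPotential` along flows. -/
def firingRate (T : ℝ) (r : Fin N → ℝ) : ℝ := ∑ j, 1 / (r j * T)

lemma firingRate_nonneg (hT : 0 < T) (hr : ∀ i, r i ∈ Ioo (0 : ℝ) 1) : 0 ≤ firingRate T r :=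
  Finset.sum_nonneg fun j _ => one_div_nonneg.2 (mul_pos (hr j).1 hT).le

lemma firingPotential_nonneg (hr : ∀ i, r i ∈ Ioo (0 : ℝ) 1) {y : State N} (hy : y ∈ flowSet N) :
    0 ≤ firingPotential r y :=
  Finset.sum_nonneg fun j _ => div_nonneg (le_min (hy j).1 (hr j).1.le) (hr j).1.le

lemma firingPotential_le (hr : ∀ i, r i ∈ Ioo (0 : ℝ) 1) (y : State N) :
    firingPotential r y ≤ N := by
  have : firingPotential r y ≤ ∑ _j : Fin N, (1 : ℝ) :=
    Finset.sum_le_sum fun j _ => (div_le_one (hr j).1).2 (min_le_right _ _)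
  simpa using this

lemma firingPotential_shift_le (hT : 0 < T) (hr : ∀ i, r i ∈ Ioo (0 : ℝ) 1) (y : State N) {c : ℝ}
    (hc : 0 ≤ c) : firingPotential r (shift y c) ≤ firingPotential r y + c * T * firingRate T r := by
  rw [firingPotential, firingPotential, firingRate, Finset.mul_sum, ← Finset.sum_add_distrib]
  refine Finset.sum_le_sum fun j _ => ?_
  have h1 := (hr j).1
  rw [show min (y j) (r j) / r j + c * T * (1 / (r j * T)) = (min (y j) (r j) + c) / r j by
    field_simp]
  refine div_le_div_of_nonneg_right ?_ h1.le
  rw [shift_apply, ← min_add_add_right]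
  exact min_le_min le_rfl (by linarith)

lemma FiresTo.firingPotential_le (hr : ∀ i, r i ∈ Ioo (0 : ℝ) 1) {i : Fin N} {z g : State N}
    {s : Input G} (h : FiresTo r G i z s g) : firingPotential r g + 1 ≤ firingPotential r z := by
  rw [firingPotential, firingPotential, ← Finset.add_sum_erase _ _ (Finset.mem_univ i),
    ← Finset.add_sum_erase _ _ (Finset.mem_univ i), h.2.1, h.2.2.1,
    min_eq_left (hr i).1.le, min_eq_right (hr i).2.le, div_self (hr i).1.ne', zero_div, zero_add,
    add_comm]
  refine add_le_add le_rfl (Finset.sum_le_sum fun j hj => ?_)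
  refine div_le_div_of_nonneg_right ?_ (hr j).1.le
  obtain ⟨h1, h2⟩ := h.2.2.2 j (Finset.ne_of_mem_erase hj)
  have h0 := (h.1 j).1
  by_cases ha : G.Adj i j
  · obtain ⟨h3, h4⟩ := h1 ha
    cases hs : s ⟨i, j, ha⟩
    · rw [h4 hs]
    · have hz : 0 ≤ min (z j) (r j) := le_min h0 (hr j).1.le
      rcases h3 hs with ⟨_, h⟩ | ⟨hz, _⟩ | ⟨hz, _⟩
      · rw [h, min_eq_left (hr j).1.le]; exact hz
      · rw [hz, min_self]; exact min_le_right _ _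
      · rw [min_eq_right hz.1.le]; exact min_le_right _ _
  · rw [h2 ha]

lemma IsSolution.jumps_le (hT : 0 < T) (hr : ∀ i, r i ∈ Ioo (0 : ℝ) 1)
    {w : ℕ → Input G} {x : HybridArc (State N)}
    (hx : IsSolution (oscillatorNetwork T p r G) w x) {t₁ t₂ : ℝ} {k₁ k₂ : ℕ}
    (h₁ : (t₁, k₁) ∈ x.dom) (h₂ : (t₂, k₂) ∈ x.dom) (ht : t₁ ≤ t₂) :
    (k₂ : ℝ) - k₁ ≤ N + (t₂ - t₁) * firingRate T r := by
  rcases lt_or_ge k₂ k₁ with hk | hk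
  · have h3 : (k₂ : ℝ) < k₁ := by exact_mod_cast hk
    have := mul_nonneg (sub_nonneg.2 ht) (firingRate_nonneg (T := T) hT hr)
    have : (0 : ℝ) ≤ N := Nat.cast_nonneg _
    linarith
  have hS := x.isHybridTimeDomain
  have key := hS.induction_from (M := fun t k => (k : ℝ) - k₁ + firingPotential r (x.val t k) ≤
    N + (t - t₁) * firingRate T r) h₁ (by simpa using firingPotential_le hr _)
    (fun k t t' h h' hle hM => ?_) (fun k t h h' hM => ?_) h₂ hk ht
  · have := firingPotential_nonneg hr (hx.mem_flowSet hr h₂)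
    linarith
  · rw [hx.val_eq_shift h h' hle]
    have := firingPotential_shift_le hT hr (x.val t k) (c := (t' - t) / T)
      (div_nonneg (sub_nonneg.2 hle) hT.le)
    rw [div_mul_cancel₀ _ hT.ne'] at this
    linarith
  · obtain ⟨i, hi⟩ := hx.exists_firesTo hr h h'
    have := hi.firingPotential_le hr
    push_cast
    linarith

lemma IsSolution.isUniformlyNonZenoWith (hT : 0 < T) (hr : ∀ i, r i ∈ Ioo (0 : ℝ) 1)
    {w : ℕ → Input G} {x : HybridArc (State N)}
    (hx : IsSolution (oscillatorNetwork T p r G) w x) :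
    x.IsUniformlyNonZenoWith 1 (N + firingRate T r) := by
  intro t₁ k₁ t₂ k₂ h₁ h₂ hb
  have hL := firingRate_nonneg hT hr
  have hN : (0 : ℝ) ≤ N := Nat.cast_nonneg _
  rcases le_or_gt k₂ k₁ with hk | hk
  · have : (k₂ : ℝ) ≤ k₁ := by exact_mod_cast hk
    linarith
  · have := hx.jumps_le hT hr h₁ h₂ (x.isHybridTimeDomain.le_of_lt h₁ h₂ hk)
    have := mul_le_mul_of_nonneg_right hb hL
    linarith

/-! ### States with all phases in a short arc of the circle -/

/-- The phases, modulo `1`, lie in an arc of length `η`. -/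
def InArc (η : ℝ) (y : State N) : Prop :=
  ∃ a : ℝ, ∀ j, ∃ n : ℤ, a ≤ y j - n ∧ y j - n ≤ a + η

lemma InArc.shift {η : ℝ} {y : State N} (h : InArc η y) (c : ℝ) : InArc η (shift y c) := by
  obtain ⟨a, ha⟩ := h
  refine ⟨a + c, fun j => ?_⟩
  obtain ⟨n, h1, h2⟩ := ha j
  exact ⟨n, by simp only [shift_apply]; linarith, by simp only [shift_apply]; linarith⟩

/-- A firing moves phases only to `0 ≡ 1`, which belongs to the arc, as the firing agent is
there. -/
lemma FiresTo.inArc {η : ℝ} {i : Fin N} {z g : State N} {s : Input G} (h : FiresTo r G i z s g)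
    (hz : InArc η z) : InArc η g := by
  obtain ⟨a, ha⟩ := hz
  obtain ⟨m, hm1, hm2⟩ := ha i
  rw [h.2.1] at hm1 hm2
  have h0 : ∀ j, g j = 0 → ∃ n : ℤ, a ≤ g j - n ∧ g j - n ≤ a + η := fun j hj =>
    ⟨m - 1, by rw [hj]; push_cast; linarith, by rw [hj]; push_cast; linarith⟩
  have h1 : ∀ j, g j = 1 → ∃ n : ℤ, a ≤ g j - n ∧ g j - n ≤ a + η := fun j hj =>
    ⟨m, by rw [hj]; exact hm1, by rw [hj]; exact hm2⟩
  refine ⟨a, fun j => ?_⟩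
  by_cases hji : j = i
  · exact h0 j (hji ▸ h.2.2.1)
  obtain ⟨h2, h3⟩ := h.2.2.2 j hji
  by_cases hadj : G.Adj i j
  · obtain ⟨h4, h5⟩ := h2 hadj
    cases hs : s ⟨i, j, hadj⟩
    · exact h5 hs ▸ ha j
    · rcases h4 hs with ⟨_, h⟩ | ⟨_, h | h⟩ | ⟨_, h⟩
      exacts [h0 j h, h0 j h, h1 j h, h1 j h]
  · exact h3 hadj ▸ ha j

lemma InArc.exists_mem_syncSet {η : ℝ} {y : State N} (h : InArc η y) (hy : y ∈ flowSet N) :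
    ∃ τ ∈ syncSet N, ∀ j, |y j - τ j| ≤ η := by
  obtain ⟨a₀, ha₀⟩ := h
  -- normalize the arc so that it starts in `[0, 1)`
  obtain ⟨a, ⟨ha0, ha1⟩, ha⟩ : ∃ a : ℝ, (0 ≤ a ∧ a < 1) ∧
      ∀ j, ∃ n : ℤ, a ≤ y j - n ∧ y j - n ≤ a + η := by
    refine ⟨Int.fract a₀, ⟨Int.fract_nonneg _, Int.fract_lt_one _⟩, fun j => ?_⟩
    obtain ⟨n, h1, h2⟩ := ha₀ j
    have := Int.floor_add_fract a₀
    exact ⟨n + ⌊a₀⌋, by push_cast; linarith, by push_cast; linarith⟩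
  have hint : ∀ n : ℤ, n ≤ -1 ∨ n = 0 ∨ 1 ≤ n := fun n => by lia
  by_cases hc : 0 < a ∧ a + η < 1
  · refine ⟨WithLp.toLp 2 fun _ => a, Or.inl ⟨a, ⟨ha0, ha1.le⟩, fun _ => rfl⟩, fun j => ?_⟩
    obtain ⟨n, h1, h2⟩ := ha j
    have hy0 := (hy j).1
    have hy1 := (hy j).2
    rcases hint n with h | rfl | h
    · have : (n : ℝ) ≤ -1 := by exact_mod_cast h
      linarith [hc.2]
    · rw [Int.cast_zero] at h1 h2
      exact abs_le.2 ⟨by change _ ≤ y j - a; linarith, by change y j - a ≤ _; linarith⟩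
    · have : (1 : ℝ) ≤ n := by exact_mod_cast h
      linarith [hc.1]
  · have key : ∀ j, y j ≤ η ∨ 1 - η ≤ y j := by
      intro j
      obtain ⟨n, h1, h2⟩ := ha j
      have hy0 := (hy j).1
      rcases ha0.eq_or_lt with h0 | h0
      · rcases le_or_gt n 0 with h | h
        · have : (n : ℝ) ≤ 0 := by exact_mod_cast h
          left; linarith
        · have : (1 : ℝ) ≤ n := by exact_mod_cast h
          right; linarith
      · have h3 : 1 ≤ a + η := not_lt.1 fun h => hc ⟨h0, h⟩
        rcases lt_or_ge n 0 with h | h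
        · have : (n : ℝ) ≤ -1 := by
            have : n ≤ -1 := by lia
            exact_mod_cast this
          left; linarith
        · have : (0 : ℝ) ≤ n := by exact_mod_cast h
          right; linarith
    refine ⟨WithLp.toLp 2 fun j => if y j ≤ η then 0 else 1, Or.inr fun j => ?_, fun j => ?_⟩
    · by_cases h : y j ≤ η <;> simp [h]
    · have hy0 := (hy j).1
      have hy1 := (hy j).2
      by_cases h : y j ≤ η
      · simp only [h, if_true, sub_zero, abs_of_nonneg hy0]
      · have := (key j).resolve_left h
        simp only [h, if_false]
        exact abs_le.2 ⟨by linarith, by linarith⟩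

lemma inArc_zero_iff {y : State N} (hy : y ∈ flowSet N) : InArc 0 y ↔ y ∈ syncSet N := by
  constructor
  · intro h
    obtain ⟨τ, hτ, h⟩ := h.exists_mem_syncSet hy
    have : y = τ := by
      ext j
      exact sub_eq_zero.1 (abs_nonpos_iff.1 (h j))
    exact this ▸ hτ
  · rintro (⟨c, _, h⟩ | h)
    · exact ⟨c, fun j => ⟨0, by simp [h j]⟩⟩
    · refine ⟨0, fun j => ?_⟩
      rcases h j with h | h
      · exact ⟨0, by simp [h]⟩
      · exact ⟨1, by simp [h]⟩

lemma IsSolution.inArc (hr : ∀ i, r i ∈ Ioo (0 : ℝ) 1) {w : ℕ → Input G}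
    {x : HybridArc (State N)} (hx : IsSolution (oscillatorNetwork T p r G) w x) {η t₁ t₂ : ℝ}
    {k₁ k₂ : ℕ} (h₁ : (t₁, k₁) ∈ x.dom) (h₂ : (t₂, k₂) ∈ x.dom) (hk : k₁ ≤ k₂) (ht : t₁ ≤ t₂)
    (h : InArc η (x.val t₁ k₁)) : InArc η (x.val t₂ k₂) := by
  refine x.isHybridTimeDomain.induction_from (M := fun t k => InArc η (x.val t k)) h₁ h
    (fun k t t' h h' hle hM => ?_) (fun k t h h' hM => ?_) h₂ hk ht
  · rw [hx.val_eq_shift h h' hle]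
    exact hM.shift _
  · obtain ⟨i, hi⟩ := hx.exists_firesTo hr h h'
    exact hi.inArc hM

lemma IsSolution.mem_syncSet (hr : ∀ i, r i ∈ Ioo (0 : ℝ) 1) {w : ℕ → Input G}
    {x : HybridArc (State N)} (hx : IsSolution (oscillatorNetwork T p r G) w x) {t₁ t₂ : ℝ}
    {k₁ k₂ : ℕ} (h₁ : (t₁, k₁) ∈ x.dom) (h₂ : (t₂, k₂) ∈ x.dom) (hk : k₁ ≤ k₂) (ht : t₁ ≤ t₂)
    (h : x.val t₁ k₁ ∈ syncSet N) : x.val t₂ k₂ ∈ syncSet N :=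
  (inArc_zero_iff (hx.mem_flowSet hr h₂)).1
    (hx.inArc hr h₁ h₂ hk ht ((inArc_zero_iff (hx.mem_flowSet hr h₁)).2 h))

/-! ### Stability -/

lemma norm_le_of_forall_abs_le {y : State N} {η : ℝ} (hη : 0 ≤ η) (h : ∀ j, |y j| ≤ η) :
    ‖y‖ ≤ N * η := by
  have hN : (0 : ℝ) ≤ N := Nat.cast_nonneg _
  rw [EuclideanSpace.norm_eq, Real.sqrt_le_left (mul_nonneg hN hη)]
  calc ∑ j, ‖y j‖ ^ 2 ≤ ∑ _j : Fin N, η ^ 2 :=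
        Finset.sum_le_sum fun j _ => pow_le_pow_left₀ (norm_nonneg _) (h j) 2
    _ = N * η ^ 2 := by simp
    _ ≤ (N : ℝ) ^ 2 * η ^ 2 := by
        refine mul_le_mul_of_nonneg_right ?_ (sq_nonneg η)
        exact_mod_cast Nat.le_self_pow two_ne_zero N
    _ = (N * η) ^ 2 := by ring

lemma mem_add_ball_of_forall_abs_le {A : Set (State N)} {y τ : State N} {η ε : ℝ} (hη : 0 ≤ η)
    (hτ : τ ∈ A) (h : ∀ j, |y j - τ j| ≤ η) (hε : N * η < ε) : y ∈ A + Metric.ball 0 ε := by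
  refine ⟨τ, hτ, y - τ, ?_, add_sub_cancel _ _⟩
  rw [mem_ball_zero_iff]
  exact (norm_le_of_forall_abs_le hη h).trans_lt hε

lemma inArc_of_mem_syncSet_add {y : State N} {δ : ℝ}
    (h : y ∈ syncSet N + Metric.closedBall (0 : State N) δ) : InArc (2 * δ) y := by
  obtain ⟨τ, hτ, u, hu, rfl⟩ := h
  rw [mem_closedBall_zero_iff] at hu
  have hu' : ∀ j, -δ ≤ u j ∧ u j ≤ δ := fun j =>
    abs_le.1 ((PiLp.norm_apply_le u j).trans hu)
  rcases hτ with ⟨c, _, h⟩ | h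
  · refine ⟨c - δ, fun j => ⟨0, ?_⟩⟩
    simp only [PiLp.add_apply, h j, Int.cast_zero]
    constructor <;> linarith [(hu' j).1, (hu' j).2]
  · refine ⟨-δ, fun j => ?_⟩
    rcases h j with h | h
    · refine ⟨0, ?_⟩
      simp only [PiLp.add_apply, h, Int.cast_zero]
      constructor <;> linarith [(hu' j).1, (hu' j).2]
    · refine ⟨1, ?_⟩
      simp only [PiLp.add_apply, h, Int.cast_one]
      constructor <;> linarith [(hu' j).1, (hu' j).2]

variable {Ω : Type*} [MeasurableSpace Ω] {P : Measure Ω} {v : ℕ → Ω → Input G}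

lemma staysNear_of_forall {x : Ω → HybridArc (State N)} {A : Set (State N)} {ε ρ γ : ℝ}
    (h : ∀ ω t k, (t, k) ∈ (x ω).dom → (x ω).val t k ∈ A + Metric.ball 0 ε) :
    StaysNear P x A ε ρ γ := by
  have : {ω | ¬ ∀ t k, (t, k) ∈ (x ω).dom → γ ≤ t + (k : ℝ) →
    (x ω).val t k ∈ A + Metric.ball 0 ε} = ∅ :=
    eq_empty_of_forall_notMem fun ω hω => hω fun t k ht _ => h ω t k ht
  rw [StaysNear, this, measure_empty]
  exact zero_le

theorem lyapunovStable (hr : ∀ i, r i ∈ Ioo (0 : ℝ) 1) :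
    LyapunovStableInProbability (oscillatorNetwork T p r G) P v (syncSet N) := by
  intro ε hε ρ _
  have hN : (0 : ℝ) < N + 1 := by positivity
  refine ⟨ε / (2 * (N + 1)), by positivity, fun x₀ hx₀ x hx => staysNear_of_forall
    fun ω t k ht => ?_⟩
  have hsol := hx.1.solution ω
  have hS := (x ω).isHybridTimeDomain
  have harc := hsol.inArc hr hS.zero_mem ht (Nat.zero_le _) (hS.1 _ ht)
    (hx.1.init ω ▸ inArc_of_mem_syncSet_add hx₀)
  obtain ⟨τ, hτ, h⟩ := harc.exists_mem_syncSet (hsol.mem_flowSet hr ht)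
  refine mem_add_ball_of_forall_abs_le (by positivity) hτ h ?_
  rw [show (N : ℝ) * (2 * (ε / (2 * (N + 1)))) = N * ε / (N + 1) by field_simp, div_lt_iff₀ hN]
  linarith

theorem lagrangeStable (hr : ∀ i, r i ∈ Ioo (0 : ℝ) 1) :
    LagrangeStableInProbability (oscillatorNetwork T p r G) P v (syncSet N) := by
  intro δ _ ρ _
  refine ⟨N + 1, by positivity, fun x₀ hx₀ x hx => staysNear_of_forall fun ω t k ht => ?_⟩
  have h := (hx.1.solution ω).mem_flowSet hr ht
  refine mem_add_ball_of_forall_abs_le (τ := 0) (η := 1) zero_le_one (Or.inr fun j => Or.inl rfl)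
    (fun j => ?_) (by linarith)
  rw [PiLp.zero_apply, sub_zero, abs_of_nonneg (h j).1]
  exact (h j).2

/-! ### Solutions with finitely many jumps, existence and completeness -/

/-- The arc that is in the state `y k` at the time `t k`, when the level `k` is entered, and flows
until the time `t (k + 1)`, for `k ≤ K`. -/
def flowArc (T : ℝ) (K : ℕ) (t : ℕ → ℝ) (h0 : t 0 = 0) (hm : ∀ k ≤ K, t k ≤ t (k + 1))
    (y : ℕ → State N) : HybridArc (State N) where
  dom := {q | q.2 ≤ K ∧ q.1 ∈ Icc (t q.2) (t (q.2 + 1))}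
  val := fun s k => shift (y k) ((s - t k) / T)
  isHybridTimeDomain := isHybridTimeDomain_of_jumpTimes h0 hm
  absCont := fun k a b _ _ _ => by
    refine ContDiffOn.absolutelyContinuousOnInterval (ContDiff.contDiffOn ?_)
    unfold shift
    fun_prop

lemma hasDerivAt_shift (y : State N) (a s : ℝ) :
    HasDerivAt (fun s => shift y ((s - a) / T)) (WithLp.toLp 2 fun _ : Fin N => 1 / T) s := by
  have h : (fun s => shift y ((s - a) / T)) =
      fun s => y + (s - a) • (WithLp.toLp 2 fun _ : Fin N => 1 / T : State N) := by
    funext s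
    ext i
    simp [div_eq_mul_inv]
  rw [h]
  simpa using (((hasDerivAt_id s).sub_const a).smul_const
    (WithLp.toLp 2 fun _ : Fin N => 1 / T : State N)).const_add y

lemma flowArc_isSolution (hT : 0 < T) {K : ℕ} {t : ℕ → ℝ} {h0 : t 0 = 0}
    {hm : ∀ k ≤ K, t k ≤ t (k + 1)} {y : ℕ → State N} {w : ℕ → Input G}
    (hy : ∀ k ≤ K, y k ∈ flowSet N)
    (hy' : ∀ k ≤ K, shift (y k) ((t (k + 1) - t k) / T) ∈ flowSet N)
    (hj : ∀ k < K, shift (y k) ((t (k + 1) - t k) / T) ∈ jumpSet N ∧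
      y (k + 1) ∈ jumpMap r G (shift (y k) ((t (k + 1) - t k) / T)) (w k)) :
    IsSolution (oscillatorNetwork T p r G) w (flowArc T K t h0 hm y) where
  init := by
    refine Or.inl ?_
    change shift (y 0) ((0 - t 0) / T) ∈ flowSet N
    simpa [h0] using hy 0 (Nat.zero_le _)
  flow := by
    rintro k t₁ t₂ ⟨hk, h1⟩ ⟨_, h2⟩ _ s hs
    refine ⟨fun i => ?_, (hasDerivAt_shift (y k) (t k) s).hasDerivWithinAt⟩
    have h3 := (hy k hk i).1
    have h4 := (hy' k hk i).2
    rw [shift_apply] at h4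
    have h5 : 0 ≤ (s - t k) / T := div_nonneg (by linarith [h1.1, hs.1]) hT.le
    have h6 : (s - t k) / T ≤ (t (k + 1) - t k) / T :=
      div_le_div_of_nonneg_right (by linarith [h2.2, hs.2]) hT.le
    simp only [flowArc, shift_apply]
    exact ⟨by linarith, by linarith⟩
  jump := by
    rintro k s ⟨_, h1⟩ ⟨hk, h2⟩
    have hs : s = t (k + 1) := le_antisymm h1.2 h2.1
    subst hs
    have := hj k hk
    refine ⟨this.1, ?_⟩
    change shift (y (k + 1)) ((t (k + 1) - t (k + 1)) / T) ∈ jumpMap r G _ (w k)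
    rw [sub_self, zero_div, shift_zero]
    exact this.2

lemma isClosed_graph_flowArc {K : ℕ} {t : ℕ → ℝ} {h0 : t 0 = 0}
    {hm : ∀ k ≤ K, t k ≤ t (k + 1)} {y : ℕ → State N} : IsClosed (flowArc T K t h0 hm y).graph := by
  have : (flowArc T K t h0 hm y).graph = ⋃ k ∈ Iic K,
      (fun s : ℝ => (s, k, shift (y k) ((s - t k) / T))) '' Icc (t k) (t (k + 1)) := by
    ext ⟨s, k, z⟩
    simp only [HybridArc.graph, flowArc, mem_ofPred_eq, mem_iUnion, mem_image, Prod.mk.injEq,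
      mem_Iic, exists_prop]
    constructor
    · rintro ⟨⟨hk, hs⟩, rfl⟩
      exact ⟨k, hk, s, hs, rfl, rfl, rfl⟩
    · rintro ⟨k, hk, s, hs, rfl, rfl, rfl⟩
      exact ⟨⟨hk, hs⟩, rfl⟩
  rw [this]
  refine (finite_Iic K).isClosed_biUnion fun k _ => (isCompact_Icc.image ?_).isClosed
  unfold shift
  fun_prop

lemma jumpMap_nonempty (hr : ∀ i, r i ∈ Ioo (0 : ℝ) 1) {z : State N} (hz : z ∈ jumpSet N)
    (s : Input G) : (jumpMap r G z s).Nonempty := by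
  classical
  obtain ⟨hfl, i, hi⟩ := hz
  choose u hu using fun j => phaseUpdate_nonempty (ρ := r j) (hfl j)
  refine ⟨WithLp.toLp 2 fun j => if j = i then 0 else
    if ∃ h : G.Adj i j, s ⟨i, j, h⟩ = true then u j else z j, (mem_jumpMap_iff hr).2
    ⟨i, hfl, hi, by simp, fun j hj => ⟨fun ha => ⟨fun hs => ?_, fun hs => ?_⟩, fun ha => ?_⟩⟩⟩
  · simpa [hj, ha, hs] using hu j
  · simp [hj, ha, hs]
  · simp [hj, ha]

/-- From a state in the flow set one may always flow until some agent reaches `1`, and jump. Hence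
maximal solutions are complete. -/
theorem IsMaximalSolution.isComplete [Nonempty (Fin N)] (hT : 0 < T)
    (hr : ∀ i, r i ∈ Ioo (0 : ℝ) 1) {w : ℕ → Input G} {x : HybridArc (State N)}
    (hx : IsMaximalSolution (oscillatorNetwork T p r G) w x) : x.IsComplete := by
  intro hbdd
  obtain ⟨B, hB⟩ := hbdd.subset_closedBall ((0 : ℝ), 0)
  have hS := x.isHybridTimeDomain
  have hB' : ∀ u k, (u, k) ∈ x.dom → u ≤ max B 0 ∧ k ≤ ⌈B⌉₊ := by
    intro u k h
    have h1 := hB h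
    rw [Metric.mem_closedBall, Prod.dist_eq, max_le_iff, Real.dist_eq, Nat.dist_eq] at h1
    simp only [sub_zero, Nat.cast_zero, abs_le] at h1
    exact ⟨le_max_of_le_left h1.1.2, by exact_mod_cast h1.2.2.trans (Nat.le_ceil B)⟩
  obtain ⟨K, t, h0, hm, h⟩ := hS.exists_jumpTimes (le_max_right B 0) ⌈B⌉₊
  have hdom : ∀ u k, (u, k) ∈ x.dom ↔ k ≤ K ∧ t k ≤ u ∧ u ≤ t (k + 1) := fun u k =>
    ⟨fun hu => (h u k).1 ⟨hu, hB' u k hu⟩, fun hu => ((h u k).2 hu).1⟩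
  have hstart : ∀ k ≤ K, (t k, k) ∈ x.dom := fun k hk => (hdom _ _).2 ⟨hk, le_rfl, hm k hk⟩
  have hend : ∀ k ≤ K, (t (k + 1), k) ∈ x.dom := fun k hk => (hdom _ _).2 ⟨hk, hm k hk, le_rfl⟩
  have hval : ∀ k u, (u, k) ∈ x.dom → x.val u k = shift (x.val (t k) k) ((u - t k) / T) :=
    fun k u hu => hx.1.val_eq_shift (hstart k ((hdom _ _).1 hu).1) hu ((hdom _ _).1 hu).2.1
  obtain ⟨c, hc, hz⟩ := exists_shift_mem_jumpSet (hx.1.mem_flowSet hr (hend K le_rfl))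
  obtain ⟨g, hg⟩ := jumpMap_nonempty hr hz (w K)
  set e := t (K + 1) + c * T with he
  have hce : 0 ≤ c * T := mul_nonneg hc hT.le
  -- prolong the last level up to the time `e`, and append a jump at this time
  let t' : ℕ → ℝ := fun k => if k ≤ K then t k else e
  let y' : ℕ → State N := fun k => if k ≤ K then x.val (t k) k else g
  have ht'le : ∀ k ≤ K, t' k = t k := fun k hk => by simp [t', hk]
  have ht'gt : ∀ k, K < k → t' k = e := fun k hk => by simp [t', hk]
  have hy'le : ∀ k ≤ K, y' k = x.val (t k) k := fun k hk => by simp [y', hk]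
  have h0' : t' 0 = 0 := by simp [t', h0]
  have hsucc : ∀ k ≤ K, t (k + 1) ≤ t' (k + 1) := by
    intro k hk
    rcases hk.lt_or_eq with hlt | rfl
    · exact (ht'le _ hlt).ge
    · rw [ht'gt _ (Nat.lt_succ_self _)]; linarith
  have hm' : ∀ k ≤ K + 1, t' k ≤ t' (k + 1) := by
    intro k hk
    rcases Nat.lt_or_ge K k with hlt | hle
    · rw [ht'gt k hlt, ht'gt (k + 1) (by lia)]
    · rw [ht'le k hle]; exact (hm k hle).trans (hsucc k hle)
  have hshiftK : shift (y' K) ((t' (K + 1) - t' K) / T) = shift (x.val (t (K + 1)) K) c := by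
    rw [hy'le K le_rfl, ht'le K le_rfl, ht'gt _ (Nat.lt_succ_self _), hval K _ (hend K le_rfl),
      shift_shift, he]
    congr 1
    field_simp
    ring
  have hshift : ∀ k < K, shift (y' k) ((t' (k + 1) - t' k) / T) = x.val (t (k + 1)) k := by
    intro k hk
    rw [hy'le k hk.le, ht'le k hk.le, ht'le _ hk, hval k _ (hend k hk.le)]
  have hgfl : g ∈ flowSet N := by
    obtain ⟨i, hi⟩ := (mem_jumpMap_iff hr).1 hg
    exact hi.mem_flowSet
  have hsol : IsSolution (oscillatorNetwork T p r G) w (flowArc T (K + 1) t' h0' hm' y') := by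
    refine flowArc_isSolution hT (fun k hk => ?_) (fun k hk => ?_) (fun k hk => ?_)
    · rcases Nat.lt_or_ge K k with hlt | hle
      · simp only [y', if_neg (not_le.2 hlt)]; exact hgfl
      · exact hy'le k hle ▸ hx.1.mem_flowSet hr (hstart k hle)
    · rcases lt_trichotomy k K with hlt | rfl | hlt
      · exact hshift k hlt ▸ hx.1.mem_flowSet hr (hend k hlt.le)
      · exact hshiftK ▸ hz.1
      · rw [ht'gt k hlt, ht'gt (k + 1) (by lia), sub_self, zero_div, shift_zero]
        simp only [y', if_neg (not_le.2 hlt)]; exact hgfl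
    · rcases (Nat.lt_succ_iff.1 hk).lt_or_eq with hlt | rfl
      · rw [hshift k hlt, hy'le (k + 1) hlt]
        exact hx.1.jump k _ (hend k hlt.le) (hstart (k + 1) hlt)
      · rw [hshiftK]
        refine ⟨hz, ?_⟩
        simpa [y'] using hg
  have heq := hx.2 _ hsol ?_ ?_
  · have : (e, K + 1) ∈ (flowArc T (K + 1) t' h0' hm' y').dom :=
      ⟨le_rfl, by simp [ht'gt], by simp [ht'gt]⟩
    rw [heq, hdom] at this
    lia
  · rintro ⟨u, k⟩ hu
    obtain ⟨hk, h1, h2⟩ := (hdom u k).1 hu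
    exact ⟨hk.trans (Nat.le_succ K), (ht'le k hk).trans_le h1, h2.trans (hsucc k hk)⟩
  · intro u k hu
    have hk := ((hdom u k).1 hu).1
    rw [hval k u hu]
    simp only [flowArc, hy'le k hk, ht'le k hk]

/-- The sample paths of the solution flow until some agent reaches `1`, and then jump once. -/
theorem exists_nontrivial_randomSolution [Nonempty (Fin N)] (hT : 0 < T)
    (hr : ∀ i, r i ∈ Ioo (0 : ℝ) 1) (hv : ∀ k, Measurable (v k)) {x₀ : State N}
    (hx₀ : x₀ ∈ flowSet N) :
    ∃ x : Ω → HybridArc (State N), IsRandomSolution (oscillatorNetwork T p r G) v x₀ x ∧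
      ∀ ω, (x ω).IsNontrivial := by
  obtain ⟨c, hc, hz⟩ := exists_shift_mem_jumpSet hx₀
  choose g hg using fun s : Input G => jumpMap_nonempty hr hz s
  have hcT : 0 ≤ c * T := mul_nonneg hc hT.le
  let t : ℕ → ℝ := fun k => if k = 0 then 0 else c * T
  have h0 : t 0 = 0 := rfl
  have hm : ∀ k ≤ 1, t k ≤ t (k + 1) := fun k _ => by
    by_cases h : k = 0 <;> simp [t, h, hcT]
  let X : Input G → HybridArc (State N) := fun s =>
    flowArc T 1 t h0 hm fun k => if k = 0 then x₀ else g s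
  have hX : ∀ s s', (X s).graphLE 0 = (X s').graphLE 0 := by
    intro s s'
    ext ⟨u, k, z⟩
    simp only [X, HybridArc.graphLE, HybridArc.graph, flowArc, mem_ofPred_eq, Nat.le_zero]
    constructor <;> rintro ⟨h, rfl⟩ <;> exact ⟨h, rfl⟩
  refine ⟨fun ω => X (v 0 ω), ⟨fun ω => isClosed_graph_flowArc, fun O _ => ?_, fun l O _ => ?_,
    fun ω => by simp [X, flowArc, h0], fun ω => ?_⟩, fun ω => ?_⟩
  · exact hv 0 (Set.toFinite {s | ((X s).graph ∩ O).Nonempty}).measurableSet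
  · cases l with
    | zero =>
      by_cases h : ∃ s, ((X s).graphLE 0 ∩ O).Nonempty
      · obtain ⟨s, hs⟩ := h
        convert @MeasurableSet.univ Ω (inputFiltration v 0)
        ext ω
        simpa [hX (v 0 ω) s] using hs
      · convert @MeasurableSet.empty Ω (inputFiltration v 0)
        ext ω
        simpa using fun hω => h ⟨v 0 ω, hω⟩
    | succ l =>
      refine le_iSup (fun k : Fin (l + 1) => MeasurableSpace.comap (v k) inferInstance) 0 _ ?_
      exact ⟨{s | ((X s).graphLE (l + 1) ∩ O).Nonempty}, (Set.toFinite _).measurableSet, rfl⟩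
  · refine flowArc_isSolution hT (fun k _ => ?_) (fun k _ => ?_) (fun k hk => ?_)
    · by_cases h : k = 0
      · simpa [h] using hx₀
      · obtain ⟨i, hi⟩ := (mem_jumpMap_iff hr).1 (hg (v 0 ω))
        simpa [h] using hi.mem_flowSet
    · by_cases h : k = 0
      · simpa [h, t, hT.ne'] using hz.1
      · obtain ⟨i, hi⟩ := (mem_jumpMap_iff hr).1 (hg (v 0 ω))
        simpa [h, t] using hi.mem_flowSet
    · obtain rfl : k = 0 := by lia
      have e1 : shift x₀ ((t 1 - t 0) / T) = shift x₀ c := by simp [t, hT.ne']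
      simp only [if_true, zero_add, e1, one_ne_zero, if_false]
      exact ⟨hz, hg _⟩
  · refine ⟨(0, 0), ⟨Nat.zero_le _, le_rfl, hm 0 zero_le_one⟩, (c * T, 1),
      ⟨le_rfl, by simp [t], by simp [t]⟩, by simp⟩

end Deterministic

/-! ### Depth in rooted digraphs -/

section Depth

variable {N : ℕ} {G : Digraph (Fin N)} {i j : Fin N}

lemma hasPath_zero (i : Fin N) : HasPath G i i 0 :=
  ⟨fun _ => i, fun a b _ => Fin.ext (by lia), rfl, rfl, fun l => l.elim0⟩

lemma HasPath.eq_of_zero (h : HasPath G i j 0) : i = j := by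
  obtain ⟨c, _, h0, h1, _⟩ := h
  rw [← h0, ← h1]
  rfl

lemma HasPath.exists_adj {m : ℕ} (h : HasPath G i j (m + 1)) : ∃ q, HasPath G i q m ∧ G.Adj q j := by
  obtain ⟨c, hc, h0, h1, hadj⟩ := h
  refine ⟨c (Fin.last m).castSucc, ⟨fun l => c l.castSucc, fun a b hab => ?_, by simpa using h0, rfl,
    fun l => ?_⟩, ?_⟩
  · exact Fin.castSucc_injective _ (hc hab)
  · have := hadj l.castSucc
    rwa [Fin.succ_castSucc] at this
  · have := hadj (Fin.last m)
    rwa [Fin.succ_last, h1] at this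

lemma hasPath_one_of_adj (hne : i ≠ j) (h : G.Adj i j) : HasPath G i j 1 := by
  refine ⟨![i, j], ?_, rfl, rfl, fun l => ?_⟩
  · intro a b hab
    fin_cases a <;> fin_cases b <;> simp_all
  · fin_cases l
    simpa using h

lemma hasPath_two_of_adj {k : Fin N} (h1 : i ≠ j) (h2 : i ≠ k) (h3 : j ≠ k) (h : G.Adj i j)
    (h' : G.Adj j k) : HasPath G i k 2 := by
  refine ⟨![i, j, k], ?_, rfl, rfl, fun l => ?_⟩
  · intro a b hab
    fin_cases a <;> fin_cases b <;> simp_all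
  · fin_cases l
    · simpa using h
    · simpa using h'

lemma IsRoot.hasPath_vertexDepth (hi : IsRoot G i) (j : Fin N) : HasPath G i j (vertexDepth G i j) := by
  have : {m | HasPath G i j m}.Nonempty := by
    by_cases h : j = i
    · exact ⟨0, h ▸ hasPath_zero i⟩
    · exact hi j h
  exact Nat.sInf_mem this

lemma vertexDepth_le {m : ℕ} (h : HasPath G i j m) : vertexDepth G i j ≤ m := Nat.sInf_le h

lemma IsRoot.exists_adj_vertexDepth_lt (hi : IsRoot G i) (hj : j ≠ i) :
    ∃ q, G.Adj q j ∧ vertexDepth G i q < vertexDepth G i j := by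
  have h := hi.hasPath_vertexDepth j
  cases hd : vertexDepth G i j with
  | zero =>
    rw [hd] at h
    exact absurd h.eq_of_zero.symm hj
  | succ m =>
    rw [hd] at h
    obtain ⟨q, hq, hadj⟩ := h.exists_adj
    exact ⟨q, hadj, Nat.lt_succ_of_le (vertexDepth_le hq)⟩

lemma vertexDepth_le_rootDepth (i j : Fin N) : vertexDepth G i j ≤ rootDepth G i :=
  Finset.le_sup (f := vertexDepth G i) (Finset.mem_univ j)

lemma IsRoot.rootDepth_le_dep (hi : IsRoot G i) : rootDepth G i ≤ dep G := by
  classical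
  exact Finset.le_sup (f := rootDepth G) (by simpa using hi)

lemma IsRoot.one_le_rootDepth (hi : IsRoot G i) (hN : 2 ≤ N) : 1 ≤ rootDepth G i := by
  have : Nontrivial (Fin N) := Fin.nontrivial_iff_two_le.2 hN
  obtain ⟨j, hj⟩ := exists_ne i
  obtain ⟨q, _, hq⟩ := hi.exists_adj_vertexDepth_lt hj
  exact (Nat.one_le_iff_ne_zero.2 (by lia)).trans (vertexDepth_le_rootDepth i j)

lemma IsRoot.adj_of_dep_le_one (hi : IsRoot G i) (hd : dep G ≤ 1) (hj : j ≠ i) : G.Adj i j := by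
  have h := hi.hasPath_vertexDepth j
  have h1 := (vertexDepth_le_rootDepth (G := G) i j).trans (hi.rootDepth_le_dep.trans hd)
  have h0 : vertexDepth G i j ≠ 0 := fun h0 => by
    rw [h0] at h
    exact hj h.eq_of_zero.symm
  rw [show vertexDepth G i j = 0 + 1 by lia] at h
  obtain ⟨q, hq, hadj⟩ := h.exists_adj
  rwa [hq.eq_of_zero]

/-- In a digraph of depth `1`, no arc leads from a vertex that is not a root to a root. -/
lemma isRoot_of_adj_of_dep_le_one (hj : IsRoot G j) (hd : dep G ≤ 1) (h : G.Adj i j) :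
    IsRoot G i := by
  intro k hk
  by_cases hij : i = j
  · exact (hij ▸ hj) k hk
  by_cases hjk : k = j
  · exact ⟨1, hjk ▸ hasPath_one_of_adj hij h⟩
  · exact ⟨2, hasPath_two_of_adj hij hk.symm (Ne.symm hjk) h (hj.adj_of_dep_le_one hd hjk)⟩

end Depth

/-! ### Strategies for the digits -/

section Strategy

variable {N : ℕ} {T : ℝ} {r : Fin N → ℝ} {G : Digraph (Fin N)}

/-- Prescribing some digits of every input forces synchronization. The predicate `Φ a b R y` says
that, from the state `y` on, it suffices to prescribe altogether `a` digits `1` and `b` digits `0`,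
and that the jumps with prescribed digits take place within the time `R`. The digits in `S₁` and
`S₀` are prescribed before it is known which one of the agents at `1` will fire, as this choice may
depend on the input. -/
def IsStrategy (T : ℝ) (r : Fin N → ℝ) (G : Digraph (Fin N)) (Φ : ℕ → ℕ → ℝ → State N → Prop) :
    Prop :=
  ∀ a b R y, Φ a b R y → y ∈ flowSet N → y ∉ syncSet N → ∀ c, 0 ≤ c → shift y c ∈ jumpSet N →
    c * T ≤ R ∧ ∃ S₁ S₀ : Finset {i : Fin N // ∃ j, G.Adj i j}, Disjoint S₁ S₀ ∧
      ∃ a' b', S₁.card + a' ≤ a ∧ S₀.card + b' ≤ b ∧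
        ∀ s : Input G, (∀ i ∈ S₁, s i = true) → (∀ i ∈ S₀, s i = false) →
          ∀ k g, FiresTo r G k (shift y c) s g → Φ a' b' (R - c * T) g

lemma FiresTo.eq_of_digit_false {k : Fin N} {z g : State N} {s : Input G} (h : FiresTo r G k z s g)
    (hs : ∀ hk, s ⟨k, hk⟩ = false) {j : Fin N} (hj : j ≠ k) : g j = z j := by
  obtain ⟨h1, h2⟩ := h.2.2.2 j hj
  by_cases ha : G.Adj k j
  · exact (h1 ha).2 (hs _)
  · exact h2 ha

lemma FiresTo.eq_zero_or_one_of_digit_true {k : Fin N} {z g : State N} {s : Input G}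
    (h : FiresTo r G k z s g) (hs : ∀ hk, s ⟨k, hk⟩ = true) {j : Fin N} (ha : G.Adj k j) :
    g j = 0 ∨ g j = 1 := by
  by_cases hj : j = k
  · exact Or.inl (hj ▸ h.2.2.1)
  rcases ((h.2.2.2 j hj).1 ha).1 (hs _) with ⟨_, h⟩ | ⟨_, h⟩ | ⟨_, h⟩
  exacts [Or.inl h, h, Or.inr h]

lemma FiresTo.eq_zero (hr : ∀ i, r i ∈ Ioo (0 : ℝ) 1) {k : Fin N} {z g : State N} {s : Input G}
    (h : FiresTo r G k z s g) {j : Fin N} (hz : z j = 0) : g j = 0 := by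
  by_cases hj : j = k
  · exact hj ▸ h.2.2.1
  obtain ⟨h1, h2⟩ := h.2.2.2 j hj
  by_cases ha : G.Adj k j
  · cases hs : s ⟨k, j, ha⟩
    · exact ((h1 ha).2 hs).trans hz
    · rcases (h1 ha).1 hs with ⟨_, h⟩ | ⟨h, _⟩ | ⟨h, _⟩
      · exact h
      · exact absurd (hz ▸ h) (hr j).1.ne
      · exact absurd (hz ▸ h.1) (hr j).1.not_gt
  · exact (h2 ha).trans hz

lemma FiresTo.eq_one (hr : ∀ i, r i ∈ Ioo (0 : ℝ) 1) {k : Fin N} {z g : State N} {s : Input G}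
    (h : FiresTo r G k z s g) {j : Fin N} (hj : j ≠ k) (hz : z j = 1) : g j = 1 := by
  obtain ⟨h1, h2⟩ := h.2.2.2 j hj
  by_cases ha : G.Adj k j
  · cases hs : s ⟨k, j, ha⟩
    · exact ((h1 ha).2 hs).trans hz
    · rcases (h1 ha).1 hs with ⟨h, _⟩ | ⟨h, _⟩ | ⟨_, h⟩
      · exact absurd (hz ▸ h.2) (hr j).2.not_gt
      · exact absurd (hz ▸ h) (hr j).2.ne'
      · exact h
  · exact (h2 ha).trans hz

open scoped Classical in
/-- Number of agents with a nonzero phase. It decreases at every jump. -/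
def numNonzero (y : State N) : ℕ := (Finset.univ.filter fun j => y j ≠ 0).card

lemma numNonzero_le (y : State N) : numNonzero y ≤ N := by
  classical
  unfold numNonzero
  exact (Finset.card_filter_le _ _).trans (by simp)

lemma FiresTo.numNonzero_lt (hr : ∀ i, r i ∈ Ioo (0 : ℝ) 1) {k : Fin N} {z g : State N}
    {s : Input G} (h : FiresTo r G k z s g) : numNonzero g < numNonzero z := by
  classical
  unfold numNonzero
  refine Finset.card_lt_card ((Finset.ssubset_iff_of_subset fun j hj => ?_).2 ⟨k, ?_, ?_⟩)
  · rw [Finset.mem_filter] at hj ⊢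
    exact ⟨hj.1, fun hz => hj.2 (h.eq_zero hr hz)⟩
  · simp [h.2.1]
  · simp [h.2.2.1]

lemma lt_one_of_shift_mem {y : State N} {c : ℝ} (hc : 0 < c) (hz : shift y c ∈ flowSet N)
    (j : Fin N) : y j < 1 := by
  have := (hz j).2
  rw [shift_apply] at this
  linarith

lemma notMem_syncSet_shift {y : State N} {c : ℝ} (hy : y ∈ flowSet N)
    (hz : shift y c ∈ flowSet N) (h : y ∉ syncSet N) : shift y c ∉ syncSet N := by
  intro h'
  refine h ((inArc_zero_iff hy).1 ?_)
  have := ((inArc_zero_iff hz).2 h').shift (-c)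
  rwa [shift_shift, add_neg_cancel, shift_zero] at this

lemma card_le_card_filter {q : Fin N → Prop} (f : Fin N → Prop) [DecidablePred q]
    [DecidablePred f] (S : Finset {i : Fin N // q i}) (hS : ∀ i ∈ S, f i) :
    S.card ≤ (Finset.univ.filter f).card := by
  rw [← Finset.card_map (Function.Embedding.subtype q)]
  refine Finset.card_le_card fun i hi => ?_
  obtain ⟨a, ha, rfl⟩ := Finset.mem_map.1 hi
  simpa using hS a ha

/-! ### Depth one: the first root that fires synchronizes the network -/

open scoped Classical in
/-- Number of digits that remain to be prescribed in a digraph of depth `1`. -/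
def rootFiringCost (G : Digraph (Fin N)) (y : State N) : ℕ :=
  if ∃ q, IsRoot G q ∧ y q = 1 then N * numNonzero y else N * N

lemma rootFiringCost_le (y : State N) : rootFiringCost G y ≤ N * N := by
  unfold rootFiringCost
  split_ifs
  · exact Nat.mul_le_mul_left _ (numNonzero_le y)
  · exact le_rfl

/-- If the depth is `1`, then a root pushes all the other agents to `0` or `1` if it fires with the
digit `1`, and only roots have arcs to roots. Hence it suffices to prescribe the digit `1` of the
roots that are about to fire. -/
lemma exists_strategy_of_dep_le_one (hr : ∀ i, r i ∈ Ioo (0 : ℝ) 1) (hT : 0 < T)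
    (hroot : IsRooted G) (hd : dep G ≤ 1) :
    ∃ Φ, IsStrategy T r G Φ ∧ ∀ y ∈ flowSet N, Φ (N * N) 0 T y := by
  classical
  refine ⟨fun a _ R y => y ∈ syncSet N ∨
    rootFiringCost G y ≤ a ∧ ∃ q, IsRoot G q ∧ (1 - y q) * T ≤ R, ?_, ?_⟩
  · rintro a b R y hΦ hy hns c hc hz
    obtain ⟨ha, q, hq, hR⟩ := hΦ.resolve_left hns
    have hcq : c ≤ 1 - y q := by
      have := (hz.1 q).2
      rw [shift_apply] at this
      linarith
    have hcT : c * T ≤ (1 - y q) * T := mul_le_mul_of_nonneg_right hcq hT.le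
    have hcost : rootFiringCost G (shift y c) ≤ a := by
      rcases hc.eq_or_lt with rfl | hc
      · rwa [shift_zero]
      · refine (rootFiringCost_le _).trans (le_trans (le_of_eq ?_) ha)
        rw [rootFiringCost, if_neg]
        rintro ⟨q, _, h⟩
        exact (lt_one_of_shift_mem hc hz.1 q).ne h
    set z := shift y c with hzdef
    refine ⟨hcT.trans hR, Finset.univ.filter fun i => IsRoot G i ∧ z i = 1, ∅,
      Finset.disjoint_empty_right _, ?_⟩
    set S₁ : Finset {i : Fin N // ∃ j, G.Adj i j} :=
      Finset.univ.filter fun i => IsRoot G i ∧ z i = 1 with hS₁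
    have hfire : ∀ s : Input G, (∀ i ∈ S₁, s i = true) → ∀ k g, FiresTo r G k z s g →
        g ∈ syncSet N ∨ ¬ IsRoot G k ∧ ∀ q, IsRoot G q → g q = z q := by
      intro s hs k g hg
      by_cases hk : IsRoot G k
      · refine Or.inl (Or.inr fun j => ?_)
        by_cases hj : j = k
        · exact Or.inl (hj ▸ hg.2.2.1)
        · exact hg.eq_zero_or_one_of_digit_true
            (fun hk' => hs _ (Finset.mem_filter.2 ⟨Finset.mem_univ _, hk, hg.2.1⟩))
            (hk.adj_of_dep_le_one hd hj)
      · refine Or.inr ⟨hk, fun q hq => ?_⟩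
        have hqk : q ≠ k := fun h => hk (h ▸ hq)
        exact (hg.2.2.2 q hqk).2 fun hadj => hk (isRoot_of_adj_of_dep_le_one hq hd hadj)
    have hRq : ∀ g : State N, g q = z q → (1 - g q) * T ≤ R - c * T := by
      intro g h
      rw [h, hzdef, shift_apply]
      linarith
    by_cases hat : ∃ q, IsRoot G q ∧ z q = 1
    · have hcost' : N * numNonzero z ≤ a := by rwa [rootFiringCost, if_pos hat] at hcost
      have hpos : 0 < numNonzero z := by
        obtain ⟨q, _, hq⟩ := hat
        exact Finset.card_pos.2 ⟨q, by simp [hq]⟩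
      have hS₁N : S₁.card ≤ N :=
        (card_le_card_filter (fun _ => True) S₁ fun _ _ => trivial).trans (by simp)
      refine ⟨N * (numNonzero z - 1), b, ?_, by simp, fun s hs _ k g hg => ?_⟩
      · calc S₁.card + N * (numNonzero z - 1) ≤ N * 1 + N * (numNonzero z - 1) := by lia
          _ = N * numNonzero z := by rw [← Nat.mul_add]; congr 1; lia
          _ ≤ a := hcost'
      · refine (hfire s hs k g hg).imp_right fun h => ⟨?_, q, hq, hRq g (h.2 q hq)⟩
        rw [rootFiringCost, if_pos]
        · exact Nat.mul_le_mul_left _ (Nat.le_sub_one_of_lt (hg.numNonzero_lt hr))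
        · obtain ⟨q, hq, h1⟩ := hat
          exact ⟨q, hq, (h.2 q hq).trans h1⟩
    · have hcost' : N * N ≤ a := by rwa [rootFiringCost, if_neg hat] at hcost
      refine ⟨a, b, ?_, by simp, fun s hs _ k g hg => ?_⟩
      · have : S₁ = ∅ := Finset.filter_eq_empty_iff.2 fun i _ hi => hat ⟨i, hi⟩
        simp [this]
      · exact (hfire s hs k g hg).imp_right fun h =>
          ⟨(rootFiringCost_le g).trans hcost', q, hq, hRq g (h.2 q hq)⟩
  · obtain ⟨i, hi⟩ := hroot
    refine fun y hy => Or.inr ⟨rootFiringCost_le y, i, hi, ?_⟩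
    have := mul_nonneg (hy i).1 hT.le
    linarith

end Strategy

/-! ### Larger depth: the network is synchronized along the layers of a root -/

section Layers

variable {N : ℕ} {T : ℝ} {r : Fin N → ℝ} {G : Digraph (Fin N)} {i : Fin N}

/-- The phase is `0 ≡ 1` on the circle. -/
def AtPole (τ : ℝ) : Prop := τ = 0 ∨ τ = 1

/-- The agent `j` has the same phase on the circle as the agent `i`. -/
def InSync (i : Fin N) (y : State N) (j : Fin N) : Prop :=
  y j = y i ∨ AtPole (y i) ∧ AtPole (y j)

/-- All out-neighbors of `q` have the same phase on the circle as `i`. -/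
def Finished (G : Digraph (Fin N)) (i : Fin N) (y : State N) (q : Fin N) : Prop :=
  ∀ j, G.Adj q j → InSync i y j

/-- The layers of depth less than `m` are finished, up to agents that are about to fire together
with the root `i`. -/
def LayersDone (G : Digraph (Fin N)) (i : Fin N) (m : ℕ) (y : State N) : Prop :=
  ∀ q, vertexDepth G i q < m → InSync i y q ∧ (Finished G i y q ∨ AtPole (y i) ∧ y q = 1)

open scoped Classical in
/-- Bounds the number of jumps at which `q` is at `1`, until `q` has fired once. -/
def waitingCost (y : State N) (q : Fin N) : ℕ := if y q = 1 then numNonzero y else N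

open scoped Classical in
/-- Number of digits `1` that remain to be prescribed, to the agents that are not finished. -/
def onesCost (G : Digraph (Fin N)) (i : Fin N) (y : State N) : ℕ :=
  ∑ q with ¬ Finished G i y q, if AtPole (y i) then waitingCost y q else N

open scoped Classical in
/-- Number of digits `0` that remain to be prescribed, if `m` layers are done: between two firings of
the root each other agent fires at most once, and in the current period only those agents fire that
are ahead of the root. -/
def zerosCost (G : Digraph (Fin N)) (i : Fin N) (m : ℕ) (y : State N) : ℕ :=
  if AtPole (y i) then (rootDepth G i - m) * (N * N)
  else (rootDepth G i - m - 1) * (N * N) + ∑ q with y i < y q, waitingCost y q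

open scoped Classical in
/-- Time until the root has fired as often as layers remain to be done, if `m` layers are done. -/
def timeCost (T : ℝ) (G : Digraph (Fin N)) (i : Fin N) (m : ℕ) (y : State N) : ℝ :=
  ((rootDepth G i : ℝ) - m - if y i = 1 then 0 else y i) * T

lemma waitingCost_le (y : State N) (q : Fin N) : waitingCost y q ≤ N := by
  unfold waitingCost
  split_ifs
  · exact numNonzero_le y
  · exact le_rfl

lemma sum_waitingCost_le (f : Fin N → Prop) [DecidablePred f] (y : State N) :
    ∑ q with f q, waitingCost y q ≤ N * N := by
  calc ∑ q with f q, waitingCost y q ≤ (Finset.univ.filter f).card • N :=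
        Finset.sum_le_card_nsmul _ _ _ fun q _ => waitingCost_le y q
    _ ≤ N * N := Nat.mul_le_mul_right _ ((Finset.card_filter_le _ _).trans (by simp))

open scoped Classical in
lemma onesCost_le_card_mul (y : State N) :
    onesCost G i y ≤ (Finset.univ.filter fun q => ¬ Finished G i y q).card * N := by
  unfold onesCost
  refine Finset.sum_le_card_nsmul _ _ _ fun q _ => ?_
  split_ifs
  · exact waitingCost_le y q
  · exact le_rfl

lemma onesCost_le (y : State N) : onesCost G i y ≤ N * N := by
  classical
  exact (onesCost_le_card_mul y).trans
    (Nat.mul_le_mul_right _ ((Finset.card_filter_le _ _).trans (by simp)))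

open scoped Classical in
lemma onesCost_eq_card_mul {y : State N}
    (h : ∀ q, (if AtPole (y i) then waitingCost y q else N) = N) :
    onesCost G i y = (Finset.univ.filter fun q => ¬ Finished G i y q).card * N := by
  simp [onesCost, h]

open scoped Classical in
/-- An agent that is not finished costs `N` digits in the state `y`, and at most `N` in the state
`z`. -/
lemma onesCost_mono {y z : State N} (h : ∀ q, (if AtPole (y i) then waitingCost y q else N) = N)
    (hf : ∀ q, Finished G i y q → Finished G i z q) : onesCost G i z ≤ onesCost G i y := by
  classical
  rw [onesCost_eq_card_mul h]
  refine (onesCost_le_card_mul z).trans (Nat.mul_le_mul_right _ (Finset.card_le_card fun q hq => ?_))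
  rw [Finset.mem_filter] at hq ⊢
  exact ⟨hq.1, fun h => hq.2 (hf q h)⟩

lemma inSync_root (y : State N) : InSync i y i := Or.inl rfl

lemma mem_syncSet_of_inSync {y : State N} (hy : y ∈ flowSet N) (h : ∀ j, InSync i y j) :
    y ∈ syncSet N := by
  by_cases hp : AtPole (y i)
  · refine Or.inr fun j => ?_
    rcases h j with h | h
    · exact h ▸ hp
    · exact h.2
  · exact Or.inl ⟨y i, hy i, fun j => (h j).resolve_right fun h => hp h.1⟩

/-- If the layers of depth less than `m` are finished, then the layer of depth `m` is in sync with
the root, since each of its agents has an in-neighbor of smaller depth. -/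
lemma inSync_of_forall_finished (hi : IsRoot G i) {m : ℕ} {y : State N}
    (hfin : ∀ q, vertexDepth G i q < m → Finished G i y q) {j : Fin N}
    (hj : vertexDepth G i j ≤ m) : InSync i y j := by
  by_cases hji : j = i
  · exact hji ▸ inSync_root y
  · obtain ⟨q, hadj, hlt⟩ := hi.exists_adj_vertexDepth_lt hji
    exact hfin q (hlt.trans_le hj) j hadj

lemma lt_rootDepth_of_forall_finished (hi : IsRoot G i) {m : ℕ} (hm : m ≤ rootDepth G i) {y : State N}
    (hy : y ∈ flowSet N) (hns : y ∉ syncSet N)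
    (hfin : ∀ q, vertexDepth G i q < m → Finished G i y q) : m < rootDepth G i := by
  refine lt_of_le_of_ne hm fun h => hns (mem_syncSet_of_inSync (i := i) hy fun j => ?_)
  exact inSync_of_forall_finished hi hfin (h ▸ vertexDepth_le_rootDepth i j)

/-- A flow up to the next firing does not increase the costs. A layer is done whenever the root
reaches `1`. -/
lemma LayersDone.exists_shift (hi : IsRoot G i) {m : ℕ} (hm : m ≤ rootDepth G i)
    {y : State N} (hy : y ∈ flowSet N) (hns : y ∉ syncSet N) (h : LayersDone G i m y) {c : ℝ}
    (hc : 0 ≤ c) (hz : shift y c ∈ flowSet N) :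
    ∃ m' ≤ rootDepth G i, LayersDone G i m' (shift y c) ∧
      onesCost G i (shift y c) ≤ onesCost G i y ∧
      zerosCost G i m' (shift y c) ≤ zerosCost G i m y ∧
      timeCost T G i m' (shift y c) + c * T = timeCost T G i m y := by
  classical
  rcases hc.eq_or_lt with rfl | hc
  · exact ⟨m, hm, by simpa using h, by simp, by simp, by simp⟩
  have hlt := lt_one_of_shift_mem hc hz
  have hfin : ∀ q, vertexDepth G i q < m → Finished G i y q := fun q hq =>
    (h q hq).2.resolve_right fun h => (hlt q).ne h.2
  have hmK := lt_rootDepth_of_forall_finished hi hm hy hns hfin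
  have hsync : ∀ j, InSync i y j → y j = y i := by
    rintro j (h | ⟨h1, h2⟩)
    · exact h
    · rw [h1.resolve_right (hlt i).ne, h2.resolve_right (hlt j).ne]
  have hsync' : ∀ j, InSync i y j → InSync i (shift y c) j := fun j hj =>
    Or.inl (by rw [shift_apply, shift_apply, hsync j hj])
  have hfin' : ∀ q, Finished G i y q → Finished G i (shift y c) q := fun q hq j hj =>
    hsync' j (hq j hj)
  have hones : onesCost G i (shift y c) ≤ onesCost G i y :=
    onesCost_mono (fun q => by simp [waitingCost, (hlt q).ne]) hfin'
  have hpos : 0 < shift y c i := by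
    have := (hy i).1
    rw [shift_apply]
    linarith
  have hK : (rootDepth G i - m) * (N * N) = (rootDepth G i - m - 1) * (N * N) + N * N := by
    obtain ⟨d, hd⟩ : ∃ d, rootDepth G i - m = d + 1 := ⟨rootDepth G i - m - 1, by lia⟩
    rw [hd, Nat.add_sub_cancel]
    ring
  by_cases hz1 : shift y c i = 1
  · refine ⟨m + 1, hmK, fun q hq => ?_, hones, ?_, ?_⟩
    · have hq' := inSync_of_forall_finished hi hfin (Nat.lt_succ_iff.1 hq)
      refine ⟨hsync' q hq', Or.inr ⟨Or.inr hz1, ?_⟩⟩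
      rw [shift_apply, hsync q hq', ← shift_apply, hz1]
    · have hp1 : AtPole (shift y c i) := Or.inr hz1
      rw [zerosCost, if_pos hp1, Nat.sub_add_eq, zerosCost]
      split_ifs <;> lia
    · rw [timeCost, timeCost, if_pos hz1, if_neg (hlt i).ne]
      rw [shift_apply] at hz1
      push_cast
      linear_combination T * hz1
  · have hnp : ¬ AtPole (shift y c i) := not_or.2 ⟨hpos.ne', hz1⟩
    refine ⟨m, hm, fun q hq => ⟨hsync' q (h q hq).1, Or.inl (hfin' q (hfin q hq))⟩, hones, ?_, ?_⟩
    · rw [zerosCost, if_neg hnp, zerosCost]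
      split_ifs
      · rw [hK]
        exact Nat.add_le_add_left (sum_waitingCost_le _ _) _
      · refine Nat.add_le_add_left ?_ _
        simp only [shift_apply, add_lt_add_iff_right]
        exact Finset.sum_le_sum fun q _ => (waitingCost_le _ q).trans
          (by simp [waitingCost, (hlt q).ne])
    · rw [timeCost, timeCost, if_neg hz1, if_neg (hlt i).ne, shift_apply]
      ring

lemma waitingCost_succ_le (hr : ∀ i, r i ∈ Ioo (0 : ℝ) 1) {k q : Fin N} {z g : State N}
    {s : Input G} (hg : FiresTo r G k z s g) (hz : z q = 1) (hq : q ≠ k) :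
    waitingCost g q + 1 ≤ waitingCost z q := by
  rw [waitingCost, waitingCost, if_pos hz, if_pos (hg.eq_one hr hq hz)]
  exact hg.numNonzero_lt hr

/-- While the root is at `0` or `1`, the agents that are about to fire and that are not finished
have to use the digit `1`. -/
lemma LayersDone.firesTo_of_atPole (hr : ∀ i, r i ∈ Ioo (0 : ℝ) 1) {m : ℕ} {z : State N}
    (h : LayersDone G i m z) (hp : AtPole (z i)) :
    ∃ S₁ : Finset {i : Fin N // ∃ j, G.Adj i j}, ∀ s : Input G, (∀ i ∈ S₁, s i = true) →
      ∀ k g, FiresTo r G k z s g → LayersDone G i m g ∧ S₁.card + onesCost G i g ≤ onesCost G i z ∧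
        zerosCost G i m g = zerosCost G i m z ∧ timeCost T G i m g = timeCost T G i m z := by
  classical
  refine ⟨Finset.univ.filter fun q => z q = 1 ∧ ¬ Finished G i z q, fun s hs k g hg => ?_⟩
  have hpole : ∀ j, AtPole (z j) → AtPole (g j) := by
    rintro j (hj | hj)
    · exact Or.inl (hg.eq_zero hr hj)
    · by_cases hjk : j = k
      · exact Or.inl (hjk ▸ hg.2.2.1)
      · exact Or.inr (hg.eq_one hr hjk hj)
  have hsz : ∀ j, InSync i z j → AtPole (z j) := by
    rintro j (hj | hj)
    · exact hj ▸ hp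
    · exact hj.2
  have hsync : ∀ j, InSync i z j → InSync i g j := fun j hj =>
    Or.inr ⟨hpole i hp, hpole j (hsz j hj)⟩
  have hfin : ∀ q, Finished G i z q → Finished G i g q := fun q hq j hj => hsync j (hq j hj)
  have hk : Finished G i g k := by
    by_cases hkf : Finished G i z k
    · exact hfin k hkf
    · exact fun j hj => Or.inr ⟨hpole i hp, hg.eq_zero_or_one_of_digit_true
        (fun hk => hs ⟨k, hk⟩ (by simp [hg.2.1, hkf])) hj⟩
  refine ⟨fun q hq => ⟨hsync q (h q hq).1, ?_⟩, ?_, ?_, ?_⟩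
  · rcases (h q hq).2 with hf | ⟨_, h1⟩
    · exact Or.inl (hfin q hf)
    · by_cases hqk : q = k
      · exact Or.inl (hqk ▸ hk)
      · exact Or.inr ⟨hpole i hp, hg.eq_one hr hqk h1⟩
  · have hcard := card_le_card_filter (fun q => z q = 1 ∧ ¬ Finished G i z q)
      (Finset.univ.filter fun q : {i : Fin N // ∃ j, G.Adj i j} => z q = 1 ∧ ¬ Finished G i z q)
      fun q hq => (Finset.mem_filter.1 hq).2
    refine (Nat.add_le_add_right hcard _).trans ?_
    simp only [onesCost, hp, hpole i hp, if_true]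
    rw [Finset.card_filter, Finset.sum_filter, Finset.sum_filter, ← Finset.sum_add_distrib]
    refine Finset.sum_le_sum fun q _ => ?_
    by_cases hqz : Finished G i z q
    · simp [hqz, hfin q hqz]
    by_cases h1 : z q = 1
    · by_cases hqk : q = k
      · subst hqk
        have := hg.numNonzero_lt hr
        simp only [h1, hqz, hk, waitingCost, not_true_eq_false, not_false_eq_true, and_self,
          if_true, if_false]
        lia
      · have := waitingCost_succ_le hr hg h1 hqk
        by_cases hqg : Finished G i g q
        · simp only [h1, hqz, hqg, not_true_eq_false, not_false_eq_true, and_self, if_true, if_false]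
          lia
        · simp only [h1, hqz, hqg, not_false_eq_true, and_self, if_true]
          lia
    · have : waitingCost z q = N := by simp [waitingCost, h1]
      have := waitingCost_le g q
      by_cases hqg : Finished G i g q
      · simp [h1, hqg]
      · simp only [h1, hqz, hqg, not_false_eq_true, false_and, if_true, if_false]
        lia
  · rw [zerosCost, zerosCost, if_pos hp, if_pos (hpole i hp)]
  · have : ∀ τ : ℝ, AtPole τ → (if τ = 1 then 0 else τ) = 0 := by
      rintro τ (rfl | rfl) <;> simp
    rw [timeCost, timeCost, this _ hp, this _ (hpole i hp)]

/-- While the root is neither at `0` nor at `1`, all the agents that are about to fire have to use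
the digit `0`. -/
lemma LayersDone.firesTo_of_not_atPole (hr : ∀ i, r i ∈ Ioo (0 : ℝ) 1) {m : ℕ} {z : State N}
    (h : LayersDone G i m z) (hp : ¬ AtPole (z i)) :
    ∃ S₀ : Finset {i : Fin N // ∃ j, G.Adj i j}, ∀ s : Input G, (∀ i ∈ S₀, s i = false) →
      ∀ k g, FiresTo r G k z s g → LayersDone G i m g ∧ onesCost G i g ≤ onesCost G i z ∧
        S₀.card + zerosCost G i m g ≤ zerosCost G i m z ∧ timeCost T G i m g = timeCost T G i m z := by
  classical
  refine ⟨Finset.univ.filter fun q => z q = 1, fun s hs k g hg => ?_⟩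
  have hne : ∀ j, j ≠ k → g j = z j := fun j hj =>
    hg.eq_of_digit_false (fun hk => hs ⟨k, hk⟩ (by simp [hg.2.1])) hj
  have hik : i ≠ k := fun h => hp (Or.inr (h ▸ hg.2.1))
  have hgi := hne i hik
  have hpg : ¬ AtPole (g i) := hgi ▸ hp
  have hsync : ∀ j, InSync i z j → InSync i g j := by
    intro j hj
    have hj := hj.resolve_right fun h => hp h.1
    have hjk : j ≠ k := fun h => hp (Or.inr (by rw [← hj, h]; exact hg.2.1))
    exact Or.inl (by rw [hne j hjk, hgi, hj])
  have hfin : ∀ q, Finished G i z q → Finished G i g q := fun q hq j hj => hsync j (hq j hj)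
  refine ⟨fun q hq => ⟨hsync q (h q hq).1, Or.inl (hfin q ((h q hq).2.resolve_right
    fun h => hp h.1))⟩, onesCost_mono (by simp [hp]) hfin, ?_, ?_⟩
  · have hcard := card_le_card_filter (fun q => z q = 1)
      (Finset.univ.filter fun q : {i : Fin N // ∃ j, G.Adj i j} => z q = 1)
      fun q hq => (Finset.mem_filter.1 hq).2
    refine (Nat.add_le_add_right hcard _).trans ?_
    rw [zerosCost, zerosCost, if_neg hp, if_neg hpg, add_left_comm]
    refine Nat.add_le_add_left ?_ _
    have hi0 : 0 ≤ z i := (hg.1 i).1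
    have hi1 : z i < 1 := lt_of_le_of_ne (hg.1 i).2 fun h => hp (Or.inr h)
    rw [Finset.card_filter, Finset.sum_filter, Finset.sum_filter, ← Finset.sum_add_distrib]
    refine Finset.sum_le_sum fun q _ => ?_
    by_cases hqk : q = k
    · subst hqk
      have := hg.numNonzero_lt hr
      rw [hg.2.2.1, hgi, if_neg hi0.not_gt, hg.2.1, if_pos rfl, if_pos hi1, waitingCost,
        if_pos hg.2.1]
      lia
    · rw [hgi, hne q hqk]
      by_cases h1 : z q = 1
      · have := waitingCost_succ_le hr hg h1 hqk
        rw [h1, if_pos rfl, if_pos hi1, if_pos hi1]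
        lia
      · have : waitingCost z q = N := by simp [waitingCost, h1]
        have := waitingCost_le g q
        rw [if_neg h1]
        split_ifs <;> lia
  · rw [timeCost, timeCost, hgi]

/-- Whenever the root fires, the next layer is synchronized with it, if the agents that fire together
with the root use the digit `1`, and the agents that fire at other times use the digit `0`. -/
lemma exists_strategy_of_isRoot (hr : ∀ i, r i ∈ Ioo (0 : ℝ) 1) (hT : 0 < T) (hN : 2 ≤ N)
    (hi : IsRoot G i) :
    ∃ Φ, IsStrategy T r G Φ ∧
      ∀ y ∈ flowSet N, Φ (N * N) (rootDepth G i * (N * N)) (rootDepth G i * T) y := by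
  classical
  refine ⟨fun a b R y => ∃ m ≤ rootDepth G i, LayersDone G i m y ∧ onesCost G i y ≤ a ∧
    zerosCost G i m y ≤ b ∧ timeCost T G i m y ≤ R, ?_, fun y hy => ?_⟩
  · rintro a b R y ⟨m, hm, hL, ha, hb, hR⟩ hy hns c hc hz
    obtain ⟨m', hm', hL', ha', hb', hR'⟩ := hL.exists_shift (T := T) hi hm hy hns hc hz.1
    have hcT : timeCost T G i m' (shift y c) ≤ R - c * T := by linarith
    have hzns := notMem_syncSet_shift hy hz.1 hns
    by_cases hp : AtPole (shift y c i)
    · refine ⟨?_, ?_⟩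
      · have : 0 ≤ timeCost T G i m' (shift y c) := by
          have h1 : (m' : ℝ) ≤ rootDepth G i := by exact_mod_cast hm'
          have h2 : (if shift y c i = 1 then 0 else shift y c i) = 0 := by
            rcases hp with h | h <;> rw [h] <;> simp
          rw [timeCost, h2]
          exact mul_nonneg (by linarith) hT.le
        linarith
      · obtain ⟨S₁, hS₁⟩ := hL'.firesTo_of_atPole (T := T) hr hp
        obtain ⟨g, hg⟩ := jumpMap_nonempty (G := G) hr hz fun _ => true
        obtain ⟨k, hk⟩ := (mem_jumpMap_iff hr).1 hg
        have hcard := (hS₁ _ (fun _ _ => rfl) k g hk).2.1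
        refine ⟨S₁, ∅, Finset.disjoint_empty_right _, onesCost G i (shift y c) - S₁.card, b,
          by lia, by simp, fun s hs _ k g hg => ?_⟩
        obtain ⟨h1, h2, h3, h4⟩ := hS₁ s hs k g hg
        exact ⟨m', hm', h1, by lia, by lia, by linarith⟩
    · have hfin : ∀ q, vertexDepth G i q < m' → Finished G i (shift y c) q := fun q hq =>
        (hL' q hq).2.resolve_right fun h => hp h.1
      have hlt := lt_rootDepth_of_forall_finished hi hm' hz.1 hzns hfin
      refine ⟨?_, ?_⟩
      · have : 0 ≤ timeCost T G i m' (shift y c) := by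
          have h1 : (m' : ℝ) + 1 ≤ rootDepth G i := by exact_mod_cast hlt
          have h2 := (hz.1 i).2
          rw [timeCost, if_neg fun h => hp (Or.inr h)]
          exact mul_nonneg (by linarith) hT.le
        linarith
      · obtain ⟨S₀, hS₀⟩ := hL'.firesTo_of_not_atPole (T := T) hr hp
        obtain ⟨g, hg⟩ := jumpMap_nonempty (G := G) hr hz fun _ => false
        obtain ⟨k, hk⟩ := (mem_jumpMap_iff hr).1 hg
        have hcard := (hS₀ _ (fun _ _ => rfl) k g hk).2.2.1
        refine ⟨∅, S₀, Finset.disjoint_empty_left _, a, zerosCost G i m' (shift y c) - S₀.card,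
          by simp, by lia, fun s _ hs k g hg => ?_⟩
        obtain ⟨h1, h2, h3, h4⟩ := hS₀ s hs k g hg
        exact ⟨m', hm', h1, by lia, by lia, by linarith⟩
  · refine ⟨0, Nat.zero_le _, fun q hq => absurd hq (Nat.not_lt_zero _), onesCost_le y, ?_, ?_⟩
    · have h1 := hi.one_le_rootDepth hN
      rw [zerosCost, Nat.sub_zero]
      split_ifs
      · exact le_rfl
      · obtain ⟨d, hd⟩ : ∃ d, rootDepth G i = d + 1 := ⟨rootDepth G i - 1, by lia⟩
        rw [hd, Nat.add_sub_cancel, Nat.succ_mul]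
        exact Nat.add_le_add_left (sum_waitingCost_le _ _) _
    · rw [timeCost]
      refine mul_le_mul_of_nonneg_right ?_ hT.le
      have := (hy i).1
      split_ifs <;> simp [this]

/-! ### The budget of digits -/

lemma ciInf_mem_Ioo [Nonempty (Fin N)] (hr : ∀ i, r i ∈ Ioo (0 : ℝ) 1) :
    (⨅ i, r i) ∈ Ioo (0 : ℝ) 1 := by
  obtain ⟨i, hi⟩ := exists_eq_ciInf_of_finite (f := r)
  exact hi ▸ hr i

lemma two_mul_le_ellStar [Nonempty (Fin N)] (hr : ∀ i, r i ∈ Ioo (0 : ℝ) 1) :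
    2 * N ≤ ellStar r := by
  have h := ciInf_mem_Ioo hr
  have : 1 ≤ ⌊1 / ⨅ i, r i⌋₊ := Nat.le_floor (by
    rw [Nat.cast_one, le_div_iff₀ h.1, one_mul]; exact h.2.le)
  rw [ellStar, mul_comm 2]
  exact Nat.mul_le_mul_left _ (by lia)

lemma IsStrategy.exists_of_le {Φ : ℕ → ℕ → ℝ → State N → Prop} (hΦ : IsStrategy T r G Φ)
    {a b a' b' : ℕ} {R : ℝ} (ha : a ≤ a') (hb : b ≤ b') (h : ∀ y ∈ flowSet N, Φ a b R y) :
    ∃ Ψ, IsStrategy T r G Ψ ∧ ∀ y ∈ flowSet N, Ψ a' b' R y := by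
  refine ⟨fun a' b' R y => ∃ a ≤ a', ∃ b ≤ b', Φ a b R y, ?_, fun y hy => ⟨a, ha, b, hb, h y hy⟩⟩
  rintro a' b' R y ⟨a, ha, b, hb, h⟩ hy hns c hc hz
  obtain ⟨hR, S₁, S₀, hd, a₁, b₁, h1, h2, h3⟩ := hΦ a b R y h hy hns c hc hz
  exact ⟨hR, S₁, S₀, hd, a₁, b₁, h1.trans ha, h2.trans hb, fun s hs hs' k g hg =>
    ⟨a₁, le_rfl, b₁, le_rfl, h3 s hs hs' k g hg⟩⟩

lemma IsRooted.one_le_dep (hroot : IsRooted G) (hN : 2 ≤ N) : 1 ≤ dep G := by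
  obtain ⟨i, hi⟩ := hroot
  exact (hi.one_le_rootDepth hN).trans hi.rootDepth_le_dep

theorem exists_strategy (hr : ∀ i, r i ∈ Ioo (0 : ℝ) 1) (hT : 0 < T) (hN : 2 ≤ N)
    (hroot : IsRooted G) :
    ∃ Φ, IsStrategy T r G Φ ∧ ∃ R ≤ dep G * T, 0 ≤ R ∧
      ∀ y ∈ flowSet N, Φ (N * ellStar r) ((dep G - 1) * (N * ellStar r)) R y := by
  have hne : Nonempty (Fin N) := ⟨⟨0, by lia⟩⟩
  have hl := two_mul_le_ellStar hr
  have hNN : N * N ≤ N * ellStar r := Nat.mul_le_mul_left _ (by lia)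
  have h1 := hroot.one_le_dep hN
  rcases h1.eq_or_lt with hd | hd
  · obtain ⟨Φ, hΦ, h⟩ := exists_strategy_of_dep_le_one hr hT hroot hd.ge
    obtain ⟨Ψ, hΨ, h'⟩ := hΦ.exists_of_le (b' := (dep G - 1) * (N * ellStar r)) hNN
      (Nat.zero_le _) h
    exact ⟨Ψ, hΨ, T, by simp [← hd], hT.le, h'⟩
  · obtain ⟨i, hi⟩ := hroot
    obtain ⟨Φ, hΦ, h⟩ := exists_strategy_of_isRoot hr hT hN hi
    have hb : rootDepth G i * (N * N) ≤ (dep G - 1) * (N * ellStar r) := by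
      calc rootDepth G i * (N * N) ≤ (2 * (dep G - 1)) * (N * N) :=
            Nat.mul_le_mul_right _ (hi.rootDepth_le_dep.trans (by lia))
        _ = (dep G - 1) * (N * (2 * N)) := by ring
        _ ≤ _ := Nat.mul_le_mul_left _ (Nat.mul_le_mul_left _ hl)
    obtain ⟨Ψ, hΨ, h'⟩ := hΦ.exists_of_le hNN hb h
    have : (rootDepth G i : ℝ) ≤ dep G := by exact_mod_cast hi.rootDepth_le_dep
    exact ⟨Ψ, hΨ, rootDepth G i * T, mul_le_mul_of_nonneg_right this hT.le,
      mul_nonneg (Nat.cast_nonneg _) hT.le, h'⟩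

end Layers

/-! ### The law of the inputs -/

section Law

variable {N : ℕ} {T p : ℝ} {r : Fin N → ℝ} {G : Digraph (Fin N)}

open scoped Classical in
/-- Probability of the input `s`. -/
def inputWeight (p : ℝ) (s : Input G) : ℝ := ∏ i, if s i then p else 1 - p

lemma inputWeight_nonneg (hp : p ∈ Ioo (0 : ℝ) 1) (s : Input G) : 0 ≤ inputWeight p s := by
  refine Finset.prod_nonneg fun i _ => ?_
  split_ifs
  · exact hp.1.le
  · exact sub_nonneg.2 hp.2.le

open scoped Classical in
lemma sum_inputWeight_filter {S₁ S₀ : Finset {i : Fin N // ∃ j, G.Adj i j}} (h : Disjoint S₁ S₀) :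
    ∑ s : Input G with (∀ i ∈ S₁, s i = true) ∧ (∀ i ∈ S₀, s i = false), inputWeight p s =
      p ^ S₁.card * (1 - p) ^ S₀.card := by
  let t : {i : Fin N // ∃ j, G.Adj i j} → Finset Bool := fun i =>
    if i ∈ S₁ then {true} else if i ∈ S₀ then {false} else Finset.univ
  have ht : (Finset.univ.filter fun s : Input G =>
      (∀ i ∈ S₁, s i = true) ∧ (∀ i ∈ S₀, s i = false)) = Fintype.piFinset t := by
    ext s
    simp only [Finset.mem_filter, Finset.mem_univ, true_and, Fintype.mem_piFinset, t]
    constructor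
    · rintro ⟨h1, h0⟩ i
      by_cases hi1 : i ∈ S₁
      · simp [hi1, h1 i hi1]
      · by_cases hi0 : i ∈ S₀
        · simp [hi1, hi0, h0 i hi0]
        · simp [hi1, hi0]
    · refine fun hs => ⟨fun i hi => by simpa [hi] using hs i, fun i hi => ?_⟩
      simpa [hi, Finset.disjoint_right.1 h hi] using hs i
  rw [ht]
  unfold inputWeight
  rw [← Finset.prod_univ_sum t fun _ b => if b then p else 1 - p]
  have : ∀ i, ∑ b ∈ t i, (if b then p else 1 - p) =
      (if i ∈ S₁ then p else 1) * (if i ∈ S₀ then 1 - p else 1) := by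
    intro i
    by_cases hi1 : i ∈ S₁
    · simp [t, hi1, Finset.disjoint_left.1 h hi1]
    · by_cases hi0 : i ∈ S₀ <;> simp [t, hi1, hi0]
  simp_rw [this]
  rw [Finset.prod_mul_distrib]
  simp [Finset.prod_ite_mem]

open scoped Classical in
lemma sum_inputWeight : ∑ s : Input G, inputWeight p s = 1 := by
  simpa using sum_inputWeight_filter (p := p) (G := G) (Finset.disjoint_empty_left ∅)

lemma inputLaw_singleton (hp : p ∈ Ioo (0 : ℝ) 1) (s : Input G) :
    (inputLaw p G).real {s} = inputWeight p s := by
  classical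
  have : inputLaw p G {s} = ENNReal.ofReal (inputWeight p s) := by
    rw [inputLaw, Measure.finsetSum_apply]
    rw [Finset.sum_eq_single s]
    · simp [inputWeight]
    · intro b _ hb
      simp [hb]
    · simp
  rw [measureReal_def, this, ENNReal.toReal_ofReal (inputWeight_nonneg hp s)]

variable {Ω : Type*} {v : ℕ → Ω → Input G}

/-- The event that the first `k` inputs are `a 0, …, a (k - 1)`. -/
def cylinder (v : ℕ → Ω → Input G) (k : ℕ) (a : ℕ → Input G) : Set Ω :=
  {ω | ∀ l < k, v l ω = a l}

lemma mem_cylinder_update {k : ℕ} {a : ℕ → Input G} {s : Input G} {ω : Ω} :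
    ω ∈ cylinder v (k + 1) (Function.update a k s) ↔ ω ∈ cylinder v k a ∧ v k ω = s := by
  constructor
  · intro h
    refine ⟨fun l hl => ?_, by simpa using h k (Nat.lt_succ_self k)⟩
    simpa [hl.ne] using h l (hl.trans (Nat.lt_succ_self k))
  · rintro ⟨h, hs⟩ l hl
    rcases (Nat.lt_succ_iff.1 hl).lt_or_eq with hlt | rfl
    · simpa [hlt.ne] using h l hlt
    · simpa using hs

variable [MeasurableSpace Ω] {P : Measure Ω}

lemma IsInputSequence.measureReal_cylinder (hp : p ∈ Ioo (0 : ℝ) 1)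
    (hv : IsInputSequence (oscillatorNetwork T p r G) P v) (k : ℕ) (a : ℕ → Input G) :
    P.real (cylinder v k a) = ∏ l ∈ Finset.range k, inputWeight p (a l) := by
  have h1 : cylinder v k a = ⋂ l ∈ Finset.range k, v l ⁻¹' {a l} := by
    ext ω
    simp [cylinder]
  rw [h1, measureReal_def, hv.indep.measure_inter_preimage_eq_mul (Finset.range k)
    (fun l _ => MeasurableSet.singleton _), ENNReal.toReal_prod]
  refine Finset.prod_congr rfl fun l _ => ?_
  rw [← inputLaw_singleton hp, measureReal_def, ← show Measure.map (v l) P = inputLaw p G from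
    hv.law l, Measure.map_apply (hv.measurable l) (MeasurableSet.singleton _)]

lemma IsInputSequence.measureReal_cylinder_update (hp : p ∈ Ioo (0 : ℝ) 1)
    (hv : IsInputSequence (oscillatorNetwork T p r G) P v) (k : ℕ) (a : ℕ → Input G)
    (s : Input G) : P.real (cylinder v (k + 1) (Function.update a k s)) =
      P.real (cylinder v k a) * inputWeight p s := by
  rw [hv.measureReal_cylinder hp, hv.measureReal_cylinder hp, Finset.prod_range_succ,
    Function.update_self]
  congr 1
  refine Finset.prod_congr rfl fun l hl => ?_
  rw [Function.update_of_ne (Finset.mem_range.1 hl).ne]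

end Law

/-! ### Adapted solutions depend on the past inputs only -/

section Adapted

variable {N : ℕ} {T p : ℝ} {r : Fin N → ℝ} {G : Digraph (Fin N)} {Ω : Type*}
  {v : ℕ → Ω → Input G}

lemma mem_iff_of_measurableSet_inputFiltration {k : ℕ} {A : Set Ω}
    (hA : MeasurableSet[inputFiltration v k] A) {ω ω' : Ω} (h : ∀ l < k, v l ω = v l ω') :
    ω ∈ A ↔ ω' ∈ A := by
  let m : MeasurableSpace Ω :=
    { MeasurableSet' := fun A => ω ∈ A ↔ ω' ∈ A
      measurableSet_empty := Iff.rfl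
      measurableSet_compl := fun A hA => not_congr hA
      measurableSet_iUnion := fun f hf => by
        simp only [mem_iUnion]
        exact exists_congr hf }
  have hle : inputFiltration v k ≤ m := by
    refine iSup_le fun l => ?_
    rintro _ ⟨B, _, rfl⟩
    change v l ω ∈ B ↔ v l ω' ∈ B
    rw [h l l.2]
  exact hle A hA

variable [MeasurableSpace Ω]

lemma IsRandomSolution.graphLE_eq {x₀ : State N} {x : Ω → HybridArc (State N)}
    (hx : IsRandomSolution (oscillatorNetwork T p r G) v x₀ x) {k : ℕ} {ω ω' : Ω}
    (h : ∀ l < k, v l ω = v l ω') : (x ω).graphLE k = (x ω').graphLE k := by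
  have hcl : ∀ ω, IsClosed ((x ω).graphLE k) := fun ω => by
    have : (x ω).graphLE k = (x ω).graph ∩ (fun q : ℝ × ℕ × State N => q.2.1) ⁻¹' Iic k := rfl
    rw [this]
    exact (hx.closed_graph ω).inter (isClosed_Iic.preimage (by fun_prop))
  -- if the closed values differed, an open set would meet just one of them
  have key : ∀ ω ω', (∀ l < k, v l ω = v l ω') → (x ω).graphLE k ⊆ (x ω').graphLE k := by
    intro ω ω' h q hq
    by_contra hq'
    obtain ⟨q', h1, h2⟩ := (mem_iff_of_measurableSet_inputFiltration
      (hx.adapted k _ (hcl ω').isOpen_compl) h).1 ⟨q, hq, hq'⟩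
    exact h2 h1
  exact (key ω ω' h).antisymm (key ω' ω fun l hl => (h l hl).symm)

lemma IsRandomSolution.enters {x₀ : State N} {x : Ω → HybridArc (State N)}
    (hx : IsRandomSolution (oscillatorNetwork T p r G) v x₀ x) {k : ℕ} {ω ω' : Ω}
    (h : ∀ l < k, v l ω = v l ω') {s : ℝ} {y : State N} (he : Enters (x ω) k s y) :
    Enters (x ω') k s y := by
  have hgr := hx.graphLE_eq h
  obtain ⟨h1, h2, h3⟩ := he
  have h4 : (s, k, y) ∈ (x ω).graphLE k := ⟨⟨h1, h2.symm⟩, le_rfl⟩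
  rw [hgr] at h4
  refine ⟨h4.1.1, h4.1.2.symm, fun t ht => ?_⟩
  have h5 : (t, k, (x ω').val t k) ∈ (x ω').graphLE k := ⟨⟨ht, rfl⟩, le_rfl⟩
  rw [← hgr] at h5
  exact h3 t h5.1.1

end Adapted

/-! ### Synchronization with positive probability in every window -/

section Windows

variable {N : ℕ} {T p : ℝ} {r : Fin N → ℝ} {G : Digraph (Fin N)} {Ω : Type*}

/-- The event that the sample path is not synchronized at some time from `d` on. -/
def desyncEvent (x : Ω → HybridArc (State N)) (d : ℝ) : Set Ω :=
  {ω | ∃ t k, (t, k) ∈ (x ω).dom ∧ d ≤ t ∧ (x ω).val t k ∉ syncSet N}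

lemma desyncEvent_anti {x : Ω → HybridArc (State N)} {d d' : ℝ} (h : d ≤ d') :
    desyncEvent x d' ⊆ desyncEvent x d := fun _ ⟨t, k, h1, h2, h3⟩ => ⟨t, k, h1, h.trans h2, h3⟩

lemma IsHybridTimeDomain.exists_mem_level {S : Set (ℝ × ℕ)} (hS : IsHybridTimeDomain S) {t : ℝ}
    {k l : ℕ} (ht : (t, k) ∈ S) (hl : l ≤ k) : ∃ u, (u, l) ∈ S := by
  induction k, hl using Nat.le_induction generalizing t with
  | base => exact ⟨t, ht⟩
  | succ k _ ih =>
    obtain ⟨s, _, hs, _⟩ := hS.exists_jump ht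
    exact ih hs

variable [MeasurableSpace Ω] {P : Measure Ω} [IsProbabilityMeasure P] {v : ℕ → Ω → Input G}

/-- A bound on the conditional probability of `E`, given the first `k` inputs, follows from bounds
given the first `k + 1` inputs, where inputs that match the prescribed digits have a better one. -/
lemma measureReal_cylinder_inter_le (hp : p ∈ Ioo (0 : ℝ) 1)
    (hv : IsInputSequence (oscillatorNetwork T p r G) P v) {k : ℕ} {a : ℕ → Input G} {E : Set Ω}
    {S₁ S₀ : Finset {i : Fin N // ∃ j, G.Adj i j}} (hS : Disjoint S₁ S₀) {u ε : ℝ}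
    (h1 : ∀ s : Input G, (∀ i ∈ S₁, s i = true) → (∀ i ∈ S₀, s i = false) →
      P.real (cylinder v (k + 1) (Function.update a k s) ∩ E) ≤
        u * (1 - ε) * P.real (cylinder v (k + 1) (Function.update a k s)))
    (h2 : ∀ s : Input G, P.real (cylinder v (k + 1) (Function.update a k s) ∩ E) ≤
        u * P.real (cylinder v (k + 1) (Function.update a k s))) :
    P.real (cylinder v k a ∩ E) ≤
      u * (1 - p ^ S₁.card * (1 - p) ^ S₀.card * ε) * P.real (cylinder v k a) := by
  classical
  set C := P.real (cylinder v k a)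
  have hcov : cylinder v k a ∩ E ⊆
      ⋃ s : Input G, cylinder v (k + 1) (Function.update a k s) ∩ E := fun ω hω =>
    mem_iUnion.2 ⟨v k ω, mem_cylinder_update.2 ⟨hω.1, rfl⟩, hω.2⟩
  calc P.real (cylinder v k a ∩ E)
      ≤ ∑ s : Input G, P.real (cylinder v (k + 1) (Function.update a k s) ∩ E) :=
        (measureReal_mono hcov).trans (measureReal_iUnion_fintype_le _)
    _ ≤ ∑ s : Input G, (u * C * inputWeight p s -
          if (∀ i ∈ S₁, s i = true) ∧ (∀ i ∈ S₀, s i = false)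
            then u * C * ε * inputWeight p s else 0) := by
        refine Finset.sum_le_sum fun s _ => ?_
        have hw := hv.measureReal_cylinder_update hp k a s
        split_ifs with hs
        · refine (h1 s hs.1 hs.2).trans (le_of_eq ?_)
          rw [hw]
          ring
        · refine (h2 s).trans (le_of_eq ?_)
          rw [hw]
          ring
    _ = u * (1 - p ^ S₁.card * (1 - p) ^ S₀.card * ε) * C := by
        rw [Finset.sum_sub_distrib, ← Finset.mul_sum, sum_inputWeight, ← Finset.sum_filter,
          ← Finset.mul_sum, sum_inputWeight_filter hS]
        ring

/-- While a strategy with the budget `n₁`, `n₀`, `R` is followed, the conditional probability of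
synchronization is at least `p ^ n₁ * (1 - p) ^ n₀`. Where the inputs deviate from the strategy, the
bound `u` applies, which holds for `W` units of time from any jump on. -/
lemma measureReal_cylinder_inter_desyncEvent_le_of_strategy [Nonempty (Fin N)] (hT : 0 < T)
    (hp : p ∈ Ioo (0 : ℝ) 1) (hr : ∀ i, r i ∈ Ioo (0 : ℝ) 1)
    (hv : IsInputSequence (oscillatorNetwork T p r G) P v) {x₀ : State N}
    {x : Ω → HybridArc (State N)} (hx : IsRandomSolution (oscillatorNetwork T p r G) v x₀ x)
    {Φ : ℕ → ℕ → ℝ → State N → Prop} (hΦ : IsStrategy T r G Φ) {W u : ℝ} (hW : 0 ≤ W) (hu : 0 ≤ u)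
    (ih : ∀ (k : ℕ) (a : ℕ → Input G) (s : ℝ) (y : State N), ∀ ω ∈ cylinder v k a,
      Enters (x ω) k s y →
        P.real (cylinder v k a ∩ desyncEvent x (s + W)) ≤ u * P.real (cylinder v k a))
    {d : ℝ} (M : ℕ) {k : ℕ} {a : ℕ → Input G} {s : ℝ} {y : State N} {ω : Ω} {n₁ n₀ : ℕ} {R : ℝ}
    (hM : firingPotential r y + R * firingRate T r < M) (hR : 0 ≤ R) (hy : Φ n₁ n₀ R y)
    (hω : ω ∈ cylinder v k a) (he : Enters (x ω) k s y) (hd : s + R + T + W < d) :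
    P.real (cylinder v k a ∩ desyncEvent x d) ≤
      u * (1 - p ^ n₁ * (1 - p) ^ n₀) * P.real (cylinder v k a) := by
  induction M generalizing k a s y ω n₁ n₀ R with
  | zero =>
    have h1 := firingPotential_nonneg hr
      (he.2.1 ▸ (hx.solution ω).mem_flowSet hr he.1 : y ∈ flowSet N)
    have h2 := mul_nonneg hR (firingRate_nonneg (T := T) hT hr)
    rw [Nat.cast_zero] at hM
    linarith
  | succ M ihM =>
    have hyf : y ∈ flowSet N := he.2.1 ▸ (hx.solution ω).mem_flowSet hr he.1
    have hp0 : 0 ≤ 1 - p := sub_nonneg.2 hp.2.le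
    have hp1 : 1 - p ≤ 1 := by linarith [hp.1]
    have hle1 : p ^ n₁ * (1 - p) ^ n₀ ≤ 1 :=
      mul_le_one₀ (pow_le_one₀ hp.1.le hp.2.le) (pow_nonneg hp0 _) (pow_le_one₀ hp0 hp1)
    have hnn : 0 ≤ u * (1 - p ^ n₁ * (1 - p) ^ n₀) * P.real (cylinder v k a) :=
      mul_nonneg (mul_nonneg hu (sub_nonneg.2 hle1)) measureReal_nonneg
    have hent : ∀ ω' ∈ cylinder v k a, Enters (x ω') k s y := fun ω' hω' =>
      hx.enters (fun l hl => (hω l hl).trans (hω' l hl).symm) he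
    by_cases hsync : y ∈ syncSet N
    · have : cylinder v k a ∩ desyncEvent x d = ∅ := by
        refine eq_empty_of_forall_notMem ?_
        rintro ω' ⟨hω', t, j, ht, hdt, hns⟩
        obtain ⟨h1, h2, -⟩ := hent ω' hω'
        have hst : s < t := by linarith
        have hkj : k ≤ j := by
          by_contra hlt
          exact absurd ((x ω').isHybridTimeDomain.le_of_lt ht h1 (not_le.1 hlt)) (not_le.2 hst)
        exact hns ((hx.solution ω').mem_syncSet hr h1 ht hkj hst.le (h2.symm ▸ hsync))
      rwa [this, measureReal_empty]
    obtain ⟨c, hc, hz⟩ := exists_shift_mem_jumpSet hyf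
    have hcT : 0 ≤ c * T := mul_nonneg hc hT.le
    obtain ⟨hcR, S₁, S₀, hdisj, a₁, a₀, hn₁, hn₀, hstep⟩ := hΦ n₁ n₀ R y hy hyf hsync c hc hz
    -- a path that is not synchronized at the time `d` has a further jump, in the state `shift y c`
    have hnext : ∀ sI : Input G, ∀ ω' ∈ cylinder v (k + 1) (Function.update a k sI) ∩
        desyncEvent x d, ∃ i y', FiresTo r G i (shift y c) sI y' ∧
          Enters (x ω') (k + 1) (s + c * T) y' := by
      rintro sI ω' ⟨hω', t, j, ht, hdt, -⟩
      obtain ⟨hω', hvk⟩ := mem_cylinder_update.1 hω'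
      have he' := hent ω' hω'
      have hkj : k + 1 ≤ j := by
        by_contra hlt
        rcases (show j ≤ k by lia).lt_or_eq with h | rfl
        · have := (x ω').isHybridTimeDomain.le_of_lt ht he'.1 h
          linarith
        · have := (hx.solution ω').le_of_enters hr hT he' ht
          linarith
      obtain ⟨t', ht'⟩ := (x ω').isHybridTimeDomain.exists_mem_level ht hkj
      obtain ⟨c', y', _, hz', ⟨i, hi⟩, hent'⟩ :=
        (hx.solution ω').exists_enters_succ hr hT he' ht'
      obtain rfl := shift_mem_jumpSet_unique hz' hz
      exact ⟨i, y', hvk ▸ hi, hent'⟩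
    refine (measureReal_cylinder_inter_le hp hv hdisj (u := u)
      (ε := p ^ a₁ * (1 - p) ^ a₀) (fun sI hs₁ hs₀ => ?_) (fun sI => ?_)).trans ?_
    · rcases (cylinder v (k + 1) (Function.update a k sI) ∩ desyncEvent x d).eq_empty_or_nonempty
        with h | ⟨ω', hω'⟩
      · rw [h, measureReal_empty]
        refine mul_nonneg (mul_nonneg hu (sub_nonneg.2 ?_)) measureReal_nonneg
        exact mul_le_one₀ (pow_le_one₀ hp.1.le hp.2.le) (pow_nonneg hp0 _) (pow_le_one₀ hp0 hp1)
      · obtain ⟨i, y', hi, hent'⟩ := hnext sI ω' hω'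
        refine ihM ?_ (sub_nonneg.2 hcR) (hstep sI hs₁ hs₀ i y' hi) hω'.1 hent' (by linarith)
        have h1 := hi.firingPotential_le hr
        have h2 := firingPotential_shift_le hT hr y hc
        rw [sub_mul]
        push_cast at hM
        linarith
    · rcases (cylinder v (k + 1) (Function.update a k sI) ∩ desyncEvent x d).eq_empty_or_nonempty
        with h | ⟨ω', hω'⟩
      · rw [h, measureReal_empty]
        exact mul_nonneg hu measureReal_nonneg
      · obtain ⟨i, y', hi, hent'⟩ := hnext sI ω' hω'
        refine (measureReal_mono ?_).trans (ih (k + 1) _ (s + c * T) y' ω' hω'.1 hent')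
        exact inter_subset_inter_right _ (desyncEvent_anti (by linarith))
    · refine mul_le_mul_of_nonneg_right (mul_le_mul_of_nonneg_left (sub_le_sub_left ?_ _) hu)
        measureReal_nonneg
      calc p ^ n₁ * (1 - p) ^ n₀ ≤ p ^ (S₁.card + a₁) * (1 - p) ^ (S₀.card + a₀) :=
            mul_le_mul (pow_le_pow_of_le_one hp.1.le hp.2.le hn₁)
              (pow_le_pow_of_le_one hp0 hp1 hn₀) (pow_nonneg hp0 _) (pow_nonneg hp.1.le _)
        _ = p ^ S₁.card * (1 - p) ^ S₀.card * (p ^ a₁ * (1 - p) ^ a₀) := by ring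

lemma rhoStar_eq (p : ℝ) (r : Fin N → ℝ) (G : Digraph (Fin N)) : rhoStar p r G =
    1 - p ^ (N * ellStar r) * (1 - p) ^ ((dep G - 1) * (N * ellStar r)) := by
  rw [rhoStar, mul_pow, ← pow_mul]

lemma rhoStar_mem_Ioo (hp : p ∈ Ioo (0 : ℝ) 1) (hr : ∀ i, r i ∈ Ioo (0 : ℝ) 1) (hN : 2 ≤ N) :
    rhoStar p r G ∈ Ioo (0 : ℝ) 1 := by
  have hne : Nonempty (Fin N) := ⟨⟨0, by lia⟩⟩
  have hl := two_mul_le_ellStar hr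
  have hp0 : 0 < 1 - p := sub_pos.2 hp.2
  have h1 : 0 < p * (1 - p) ^ (dep G - 1) := mul_pos hp.1 (pow_pos hp0 _)
  have h2 : p * (1 - p) ^ (dep G - 1) < 1 :=
    (mul_le_of_le_one_right hp.1.le (pow_le_one₀ hp0.le (by linarith [hp.1]))).trans_lt hp.2
  have h3 : N * ellStar r ≠ 0 := Nat.mul_ne_zero (by lia) (by lia)
  have h4 := pow_pos h1 (N * ellStar r)
  have h5 := pow_lt_one₀ h1.le h2 h3
  rw [rhoStar]
  constructor <;> linarith

/-- Each window of length `TStar` leaves room for a complete run of the strategy, including the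
time `T` that may elapse after its last prescribed jump. -/
theorem measureReal_cylinder_inter_desyncEvent_le (hT : 0 < T) (hp : p ∈ Ioo (0 : ℝ) 1)
    (hr : ∀ i, r i ∈ Ioo (0 : ℝ) 1) (hN : 2 ≤ N) (hroot : IsRooted G)
    (hv : IsInputSequence (oscillatorNetwork T p r G) P v) {x₀ : State N}
    {x : Ω → HybridArc (State N)} (hx : IsRandomSolution (oscillatorNetwork T p r G) v x₀ x)
    (n k : ℕ) (a : ℕ → Input G) (s : ℝ) (y : State N) (ω : Ω) (hω : ω ∈ cylinder v k a)
    (he : Enters (x ω) k s y) :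
    P.real (cylinder v k a ∩ desyncEvent x (s + n * TStar T r G)) ≤
      rhoStar p r G ^ n * P.real (cylinder v k a) := by
  have hne : Nonempty (Fin N) := ⟨⟨0, by lia⟩⟩
  induction n generalizing k a s y ω with
  | zero =>
    rw [pow_zero, one_mul]
    exact measureReal_mono inter_subset_left
  | succ n ih =>
    obtain ⟨Φ, hΦ, R, hR, hR0, hy⟩ := exists_strategy hr hT hN hroot
    have hd1 : (1 : ℝ) ≤ dep G := by exact_mod_cast hroot.one_le_dep hN
    have hl : (4 : ℝ) ≤ ellStar r := by
      have := two_mul_le_ellStar hr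
      exact_mod_cast (show 4 ≤ 2 * N by lia).trans this
    have hTS : R + T < TStar T r G := by
      have h1 : (dep G : ℝ) * T + T < ((dep G : ℝ) * ellStar r + 1) * T := by
        have : (dep G : ℝ) < dep G * ellStar r := by nlinarith
        nlinarith
      rw [TStar]
      linarith
    have hTS0 : 0 ≤ TStar T r G := by linarith
    obtain ⟨M, hM⟩ := exists_nat_gt (firingPotential r y + R * firingRate T r)
    rw [pow_succ, show (rhoStar p r G) ^ n * rhoStar p r G = (rhoStar p r G) ^ n *
      (1 - p ^ (N * ellStar r) * (1 - p) ^ ((dep G - 1) * (N * ellStar r))) by rw [← rhoStar_eq]]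
    refine measureReal_cylinder_inter_desyncEvent_le_of_strategy hT hp hr hv hx hΦ
      (mul_nonneg (Nat.cast_nonneg n) hTS0) (pow_nonneg (rhoStar_mem_Ioo hp hr hN).1.le n) ih M hM hR0
      (hy y (he.2.1 ▸ (hx.solution ω).mem_flowSet hr he.1)) hω he ?_
    push_cast
    linarith

theorem measure_desyncEvent_le (hT : 0 < T) (hp : p ∈ Ioo (0 : ℝ) 1)
    (hr : ∀ i, r i ∈ Ioo (0 : ℝ) 1) (hN : 2 ≤ N) (hroot : IsRooted G)
    (hv : IsInputSequence (oscillatorNetwork T p r G) P v) {x₀ : State N}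
    {x : Ω → HybridArc (State N)} (hx : IsRandomSolution (oscillatorNetwork T p r G) v x₀ x)
    (n : ℕ) : P (desyncEvent x (n * TStar T r G)) ≤ ENNReal.ofReal (rhoStar p r G ^ n) := by
  obtain ⟨ω⟩ := nonempty_of_isProbabilityMeasure P
  have h := measureReal_cylinder_inter_desyncEvent_le hT hp hr hN hroot hv hx n 0
    (fun l => v l ω) 0 _ ω (fun l hl => absurd hl (Nat.not_lt_zero l)) (enters_zero (x ω))
  have huniv : cylinder v 0 (fun l => v l ω) = univ :=
    eq_univ_of_forall fun ω' l hl => absurd hl (Nat.not_lt_zero l)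
  rw [huniv, univ_inter, probReal_univ, mul_one, zero_add, measureReal_def] at h
  exact (ENNReal.le_ofReal_iff_toReal_le (measure_ne_top _ _)
    (pow_nonneg (rhoStar_mem_Ioo hp hr hN).1.le n)).2 h

/-- The number of jumps is bounded by the elapsed time, so that `t + k` large means `t` large. -/
theorem globallyAttractive (hT : 0 < T) (hp : p ∈ Ioo (0 : ℝ) 1)
    (hr : ∀ i, r i ∈ Ioo (0 : ℝ) 1) (hroot : IsRooted G)
    (hv : IsInputSequence (oscillatorNetwork T p r G) P v) :
    GloballyAttractiveInProbability (oscillatorNetwork T p r G) P v (syncSet N) := by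
  intro ε hε ρ hρ R _
  have hball : ∀ y ∈ syncSet N, y ∈ syncSet N + Metric.ball 0 ε := fun y hy =>
    ⟨y, hy, 0, Metric.mem_ball_self hε, add_zero y⟩
  rcases Nat.lt_or_ge N 2 with hN | hN
  · -- all the states of a single agent are synchronized
    refine ⟨0, le_rfl, fun x₀ _ x hx => staysNear_of_forall fun ω t k ht => hball _ ?_⟩
    obtain ⟨i, _⟩ := hroot
    have : Subsingleton (Fin N) := Fin.subsingleton_iff_le_one.2 (by lia)
    exact Or.inl ⟨_, (hx.solution ω).mem_flowSet hr ht i, fun j => by rw [Subsingleton.elim j i]⟩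
  have hρ' := rhoStar_mem_Ioo (G := G) hp hr hN
  obtain ⟨n, hn⟩ := exists_pow_lt_of_lt_one hρ hρ'.2
  have hTS : 0 ≤ TStar T r G := mul_nonneg (by positivity) hT.le
  have hL := firingRate_nonneg (T := T) hT hr
  have hnT : 0 ≤ n * TStar T r G := mul_nonneg (Nat.cast_nonneg n) hTS
  refine ⟨n * TStar T r G + (N + n * TStar T r G * firingRate T r), by positivity,
    fun x₀ _ x hx => ?_⟩
  refine (measure_mono ?_).trans ((measure_desyncEvent_le hT hp hr hN hroot hv hx n).trans
    (ENNReal.ofReal_le_ofReal hn.le))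
  intro ω hω
  simp only [mem_ofPred_eq, not_forall] at hω
  obtain ⟨t, k, ht, hγ, hns⟩ := hω
  refine ⟨t, k, ht, ?_, fun h => hns (hball _ h)⟩
  by_contra! hlt
  have hS := (x ω).isHybridTimeDomain
  have h1 := (hx.solution ω).jumps_le hT hr hS.zero_mem ht (hS.1 _ ht)
  rw [Nat.cast_zero, sub_zero, sub_zero] at h1
  have h2 := mul_le_mul_of_nonneg_right hlt.le hL
  linarith

/-- A complete sample path passes the time `d`. If it has not met `syncSet` up to then, it is not
synchronized at the time `d`. -/
lemma IsSolution.exists_notMem_of_lt_hittingTime (hT : 0 < T) (hr : ∀ i, r i ∈ Ioo (0 : ℝ) 1)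
    {w : ℕ → Input G} {x : HybridArc (State N)}
    (hx : IsSolution (oscillatorNetwork T p r G) w x) (hc : x.IsComplete) {d : ℝ} (hd : 0 ≤ d)
    (h : (d : EReal) < x.hittingTime (syncSet N)) :
    ∃ t k, (t, k) ∈ x.dom ∧ d ≤ t ∧ x.val t k ∉ syncSet N := by
  have hS := x.isHybridTimeDomain
  have hex : ∃ t k, (t, k) ∈ x.dom ∧ d ≤ t := by
    by_contra! hlt
    refine hc ((Metric.isBounded_Icc (0 : ℝ) d).prod
      (finite_Iic ⌊(N : ℝ) + d * firingRate T r⌋₊).isBounded |>.subset ?_)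
    rintro ⟨t, k⟩ ht
    have h1 := hx.jumps_le hT hr hS.zero_mem ht (hS.1 _ ht)
    rw [Nat.cast_zero, sub_zero, sub_zero] at h1
    have h2 := mul_le_mul_of_nonneg_right (hlt t k ht).le (firingRate_nonneg (T := T) hT hr)
    exact ⟨⟨hS.1 _ ht, (hlt t k ht).le⟩, Nat.le_floor (by linarith)⟩
  obtain ⟨t, k, ht, hdt⟩ := hex
  obtain ⟨l, hl⟩ := hS.exists_mem_of_le ht hd hdt
  refine ⟨d, l, hl, le_rfl, fun hmem => h.not_ge ?_⟩
  exact sInf_le ⟨d, l, hl, hmem, rfl⟩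

end Windows

end HybridSync

end

theorem mainTheorem3 {N : ℕ} (T : ℝ) (hT : 0 < T) (p : ℝ) (hp : p ∈ Set.Ioo (0 : ℝ) 1)
    (r : Fin N → ℝ) (hr : ∀ i, r i ∈ Set.Ioo (0 : ℝ) 1)
    (G : Digraph (Fin N)) (hG : HybridSync.IsSimple G) (hroot : HybridSync.IsRooted G)
    {Ω : Type*} [MeasurableSpace Ω] (P : MeasureTheory.Measure Ω)
    [MeasureTheory.IsProbabilityMeasure P] (v : ℕ → Ω → HybridSync.Input G)
    (hv : HybridSync.IsInputSequence (HybridSync.oscillatorNetwork T p r G) P v) :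
    HybridSync.IsSyncTriplet T p r G P v ∧
    (2 ≤ N →
      HybridSync.rhoStar p r G ∈ Set.Ioo (0 : ℝ) 1 ∧
      ∀ (x₀ : HybridSync.State N) (x : Ω → HybridSync.HybridArc (HybridSync.State N)),
        HybridSync.IsMaximalRandomSolution (HybridSync.oscillatorNetwork T p r G) P v x₀ x →
        ∀ n : ℕ, 0 < n →
          P {ω | (((n : ℝ) * HybridSync.TStar T r G : ℝ) : EReal) <
              (x ω).hittingTime (HybridSync.syncSet N)} ≤
            ENNReal.ofReal (HybridSync.rhoStar p r G ^ n)) := by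
  obtain ⟨i₀, hi₀⟩ := hroot
  have hne : Nonempty (Fin N) := ⟨i₀⟩
  have hroot : HybridSync.IsRooted G := ⟨i₀, hi₀⟩
  have hfl : ∀ x₀ ∈ HybridSync.flowSet N ∪ HybridSync.jumpSet N, x₀ ∈ HybridSync.flowSet N :=
    fun x₀ h => h.elim id fun h => h.1
  refine ⟨⟨fun x₀ hx₀ => ?_, fun x₀ _ x hx => ⟨?_, ?_⟩, HybridSync.lyapunovStable hr,
    HybridSync.lagrangeStable hr, HybridSync.globallyAttractive hT hp hr hroot hv⟩, fun hN =>
    ⟨HybridSync.rhoStar_mem_Ioo hp hr hN, fun x₀ x hx n _ => ?_⟩⟩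
  · obtain ⟨x, hx, hnt⟩ := HybridSync.exists_nontrivial_randomSolution (G := G) (p := p) hT hr
      hv.measurable (hfl x₀ hx₀)
    exact ⟨x, hx, Filter.Eventually.of_forall hnt⟩
  · filter_upwards [hx.2] with ω hω using hω.isComplete hT hr
  · have hL := HybridSync.firingRate_nonneg (T := T) hT hr
    have hN : (0 : ℝ) < N := Nat.cast_pos.2 (Fin.pos i₀)
    exact ⟨1, one_pos, N + HybridSync.firingRate T r, by linarith,
      Filter.Eventually.of_forall fun ω => (hx.1.solution ω).isUniformlyNonZenoWith hT hr⟩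
  · refine le_trans (measure_mono_ae ?_)
      (HybridSync.measure_desyncEvent_le hT hp hr hN hroot hv hx.1 n)
    filter_upwards [hx.2] with ω hω hlt
    refine hω.1.exists_notMem_of_lt_hittingTime hT hr (hω.isComplete hT hr) ?_ hlt
    rw [HybridSync.TStar]
    positivity
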